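/- Let $U\subseteq\mathbb{R}^n$ be open and connected (e.g. $U=\mathbb{R}^n$), let $V(t,x)$ be a $C^2$ function on $\mathbb{R}\times U$, and write $V_{ij}=\partial^2V/\partial x^i\partial x^j$, $\Delta_xV=\sum_iV_{ii}$. Its pp-wave lift is the Lorentzian metric $$g=2\,dv\,dt-2V(t,x)\,dt^2+\sum_{i=1}^n(dx^i)^2\quad\text{on } \mathbb{R}\times\mathbb{R}\times U\ni(v,t,x),$$ with Levi-Civita connection and curvature endomorphism $R(X,Y)Z=\nabla_X\nabla_YZ-\nabla_Y\nabla_XZ-\nabla_{[X,Y]}Z$. A geodesic lift of a solution $x(t)$ of $\ddot x=-\nabla_xV(t,x)$ is a geodesic of $g$ of the form $\gamma(t)=(v(t),t,x(t))$ with the same domain as $x$; it is lightlike if $\gamma'\neq0$ and $g(\gamma',\gamma')=0$. A Jacobi field along $\gamma$ is a $C^2$ vector field $J$ along $\gamma$ with $J''+R(J,\gamma')\gamma'=0$, and $\gamma(t_1),\gamma(t_2)$ are conjugate along $\gamma$ if there is a Jacobi field on $[t_1,t_2]$, not identically zero, with $J(t_1)=J(t_2)=0$. **Theorem.** Let $x(t)$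 be a maximal, nonconstant solution of $\ddot x=-\nabla_xV$ in $U$ that is defined for all $t\in\mathbb{R}$, such that: 1. there are a time $t_0$ and an index $i$ with $\dot x^i(t_0)=0$; 2. $V_{ij}(t_0,x(t_0))\neq0$ for this $i$ and some $j\in\{1,\dots,n\}$; 3. $\Delta_xV(t,x(t))\ge0$ for all $t\in\mathbb{R}$. Then the lightlike geodesic lift $\gamma(t)=(v(t),t,x(t))$, $t\in\mathbb{R}$, of $x$ with $v(t_0)=0$ exists, and there are times $t_1<t_2$ such that $\gamma(t_1)$ and $\gamma(t_2)$ are conjugate along $\gamma$. Moreover, there is a one-parameter family of distinct solutions of $\ddot x=-\nabla_xV$ starting at $x(t_1)$ and accumulating at the later point $x(t_2)$. Precisely: for some Jacobi field $J\not\equiv0$ along $\gamma$ on $[t_1,t_2]$ with $J(t_1)=J(t_2)=0$ there are $\varepsilon>0$, pairwise distinct solutions $x_s:[t_1,t_2]\to U$ $(|s|<\varepsilon)$ of $\ddot x=-\nabla_xV$ with $x_0=x$ on $[t_1,t_2]$ and $x_s(t_1)=x(t_1)$, and geodesic lifts $\gamma_s$ of $x_s$ with $\gamma_0=\gamma$ on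 $[t_1,t_2]$ and $\gamma_s(t_1)=\gamma(t_1)$, such that $(s,t)\mapsto\gamma_s(t)$ is $C^1$ on $(-\varepsilon,\varepsilon)\times[t_1,t_2]$ and $$\frac{\partial\gamma_s(t)}{\partial s}\Big|_{s=0}=J(t)\quad\text{for all }t\in[t_1,t_2];$$ in particular $\frac{\partial x_s(t_2)}{\partial s}\big|_{s=0}=0$. -/

import Mathlib

open scoped Matrix

/-! ### Semi-Riemannian geometry in a global coordinate chart

A metric on an open subset of `ι → ℝ` is given by its component matrices `G p`. -/

section Coordinates

variable {ι : Type*} [Fintype ι] [DecidableEq ι]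

/-- The partial derivative `∂_a f` at `p`. -/
noncomputable def coordDeriv (a : ι) (f : (ι → ℝ) → ℝ) (p : ι → ℝ) : ℝ :=
  fderiv ℝ f p (Pi.single a 1)

/-- Christoffel symbols of the Levi-Civita connection,
`Γ^a_{bc} = ½ ∑_d g^{ad} (∂_b g_{dc} + ∂_c g_{bd} - ∂_d g_{bc})`. -/
noncomputable def christoffel (G : (ι → ℝ) → Matrix ι ι ℝ) (a b c : ι) (p : ι → ℝ) : ℝ :=
  (1 / 2) * ∑ d, (G p)⁻¹ a d *
    (coordDeriv b (fun q => G q d c) p + coordDeriv c (fun q => G q b d) p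
      - coordDeriv d (fun q => G q b c) p)

/-- Components of the curvature endomorphism `R(X,Y)Z = ∇_X ∇_Y Z - ∇_Y ∇_X Z - ∇_{[X,Y]} Z`:
`R(∂_c, ∂_d) ∂_b = ∑_a (curvatureCoeff G a b c d) ∂_a`. -/
noncomputable def curvatureCoeff (G : (ι → ℝ) → Matrix ι ι ℝ) (a b c d : ι) (p : ι → ℝ) : ℝ :=
  coordDeriv c (christoffel G a d b) p - coordDeriv d (christoffel G a c b) p
    + ∑ e, (christoffel G a c e p * christoffel G e d b p
      - christoffel G a d e p * christoffel G e c b p)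

/-- The curvature endomorphism `R(X,Y)Z` at the point `p`. -/
noncomputable def curvatureEndo (G : (ι → ℝ) → Matrix ι ι ℝ) (p X Y Z : ι → ℝ) : ι → ℝ :=
  fun a => ∑ b, ∑ c, ∑ d, curvatureCoeff G a b c d p * Z b * X c * Y d

/-- Covariant derivative of the vector field `X` along the curve `γ : I → (ι → ℝ)`. -/
noncomputable def covDerivAlong (G : (ι → ℝ) → Matrix ι ι ℝ) (I : Set ℝ)
    (γ X : ℝ → ι → ℝ) (t : ℝ) : ι → ℝ :=
  fun a => derivWithin X I t a
    + ∑ b, ∑ c, christoffel G a b c (γ t) * derivWithin γ I t b * X t c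

/-- `γ` is a (twice differentiable, affinely parametrized) geodesic on the interval `I`, contained
in the open set `Ω` on which the metric is defined. -/
structure IsGeodesicOn (G : (ι → ℝ) → Matrix ι ι ℝ) (Ω : Set (ι → ℝ)) (I : Set ℝ)
    (γ : ℝ → ι → ℝ) : Prop where
  mapsTo : Set.MapsTo γ I Ω
  differentiableOn : DifferentiableOn ℝ γ I
  differentiableOn_derivWithin : DifferentiableOn ℝ (derivWithin γ I) I
  covDeriv_eq_zero : ∀ t ∈ I, covDerivAlong G I γ (derivWithin γ I) t = 0

/-- `J` is a Jacobi field along `γ` on the interval `I`: it is `C²` and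
`J'' + R(J, γ')γ' = 0`. -/
structure IsJacobiFieldOn (G : (ι → ℝ) → Matrix ι ι ℝ) (I : Set ℝ)
    (γ J : ℝ → ι → ℝ) : Prop where
  contDiffOn : ContDiffOn ℝ 2 J I
  jacobi_eq : ∀ t ∈ I, covDerivAlong G I γ (covDerivAlong G I γ J) t
    + curvatureEndo G (γ t) (J t) (derivWithin γ I t) (derivWithin γ I t) = 0

/-- `J` witnesses that `γ a` and `γ b` are conjugate along `γ`: it is a nontrivial Jacobi field
on `[a, b]` vanishing at `a` and `b`. -/
structure IsConjugacyField (G : (ι → ℝ) → Matrix ι ι ℝ) (a b : ℝ)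
    (γ J : ℝ → ι → ℝ) : Prop where
  jacobi : IsJacobiFieldOn G (Set.Icc a b) γ J
  nontrivial : ∃ t ∈ Set.Icc a b, J t ≠ 0
  left_eq_zero : J a = 0
  right_eq_zero : J b = 0

end Coordinates

/-! ### Hamiltonian systems and their pp-wave lifts -/

section PPWave

variable {n : ℕ}

/-- `x` solves `ẍ = -∇ₓV(t, x)` on the interval `I`, with values in `U`. -/
structure IsNewtonSolutionOn (V : ℝ → EuclideanSpace ℝ (Fin n) → ℝ)
    (U : Set (EuclideanSpace ℝ (Fin n))) (I : Set ℝ)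
    (x : ℝ → EuclideanSpace ℝ (Fin n)) : Prop where
  mapsTo : Set.MapsTo x I U
  differentiableOn : DifferentiableOn ℝ x I
  hasDerivWithinAt : ∀ t ∈ I,
    HasDerivWithinAt (derivWithin x I) (-gradient (V t) (x t)) I t

/-- The point with Brinkmann coordinates `(v, t, x¹, …, xⁿ)`; the coordinate `v` has index
`Sum.inl 0`, `t` has index `Sum.inl 1`, and `xⁱ` has index `Sum.inr i`. -/
def brinkmannPoint (v t : ℝ) (x : EuclideanSpace ℝ (Fin n)) : Fin 2 ⊕ Fin n → ℝ :=
  Sum.elim ![v, t] (fun i => x i)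

/-- The spatial part `(x¹, …, xⁿ)` of a point. -/
def spatialPart (p : Fin 2 ⊕ Fin n → ℝ) : EuclideanSpace ℝ (Fin n) :=
  WithLp.toLp 2 (fun i => p (Sum.inr i))

/-- The pp-wave metric `2 dv dt - 2 V(t,x) dt² + ∑ᵢ (dxⁱ)²`. -/
noncomputable def ppMetric (V : ℝ → EuclideanSpace ℝ (Fin n) → ℝ) (p : Fin 2 ⊕ Fin n → ℝ) :
    Matrix (Fin 2 ⊕ Fin n) (Fin 2 ⊕ Fin n) ℝ :=
  Matrix.fromBlocks !![0, 1; 1, -2 * V (p (Sum.inl 1)) (spatialPart p)] 0 0 1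

/-- The domain `ℝ × ℝ × U` of the pp-wave metric. -/
def ppDomain (U : Set (EuclideanSpace ℝ (Fin n))) : Set (Fin 2 ⊕ Fin n → ℝ) :=
  {p | spatialPart p ∈ U}

/-- `γ` is a geodesic lift of `x` on `I`: a geodesic of the pp-wave metric of the form
`γ(t) = (v(t), t, x(t))`. -/
def IsGeodesicLiftOn (V : ℝ → EuclideanSpace ℝ (Fin n) → ℝ)
    (U : Set (EuclideanSpace ℝ (Fin n))) (I : Set ℝ)
    (x : ℝ → EuclideanSpace ℝ (Fin n)) (γ : ℝ → Fin 2 ⊕ Fin n → ℝ) : Prop :=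
  IsGeodesicOn (ppMetric V) (ppDomain U) I γ ∧
    ∃ v : ℝ → ℝ, ∀ t ∈ I, γ t = brinkmannPoint (v t) t (x t)

/-- The curve `γ` is lightlike for the metric `G`: `g(γ', γ') = 0` and `γ' ≠ 0`. -/
def IsLightlikeOn {ι : Type*} [Fintype ι] (G : (ι → ℝ) → Matrix ι ι ℝ) (I : Set ℝ)
    (γ : ℝ → ι → ℝ) : Prop :=
  ∀ t ∈ I, derivWithin γ I t ≠ 0 ∧
    derivWithin γ I t ⬝ᵥ (G (γ t) *ᵥ derivWithin γ I t) = 0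

/-- A one-parameter family of distinct solutions `X s`, `|s| < ε`, of `ẍ = -∇ₓV` on `[a, b]`
with `X 0 = x`, all starting at `x a` at time `a`, which lift to a `C¹` family `Γ s` of geodesics
of the pp-wave with `Γ 0 = γ`, all starting at `γ a`, whose infinitesimal variation
`∂Γ_s/∂s` at `s = 0` is `J`. The family accumulates at `x b` when `J b = 0`. -/
structure IsDistinctSolutionFamily (V : ℝ → EuclideanSpace ℝ (Fin n) → ℝ)
    (U : Set (EuclideanSpace ℝ (Fin n))) (a b ε : ℝ)
    (x : ℝ → EuclideanSpace ℝ (Fin n)) (γ J : ℝ → Fin 2 ⊕ Fin n → ℝ)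
    (X : ℝ → ℝ → EuclideanSpace ℝ (Fin n)) (Γ : ℝ → ℝ → Fin 2 ⊕ Fin n → ℝ) : Prop where
  pos : 0 < ε
  solution : ∀ s ∈ Set.Ioo (-ε) ε, IsNewtonSolutionOn V U (Set.Icc a b) (X s)
  start : ∀ s ∈ Set.Ioo (-ε) ε, X s a = x a
  base : Set.EqOn (X 0) x (Set.Icc a b)
  distinct : ∀ s ∈ Set.Ioo (-ε) ε, ∀ s' ∈ Set.Ioo (-ε) ε, s ≠ s' →
    ¬ Set.EqOn (X s) (X s') (Set.Icc a b)
  lift : ∀ s ∈ Set.Ioo (-ε) ε, IsGeodesicLiftOn V U (Set.Icc a b) (X s) (Γ s)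
  lift_start : ∀ s ∈ Set.Ioo (-ε) ε, Γ s a = γ a
  lift_base : Set.EqOn (Γ 0) γ (Set.Icc a b)
  contDiffOn : ContDiffOn ℝ 1 (fun p : ℝ × ℝ => Γ p.1 p.2) (Set.Ioo (-ε) ε ×ˢ Set.Icc a b)
  variation : ∀ t ∈ Set.Icc a b, HasDerivAt (fun s => Γ s t) (J t) 0

end PPWave

/-! Write `A t` for the spatial Hessian of `V` at `(t, x t)`. A spatial field `y` along `x` has the
lift `(-⟪x', y⟫, 0, y)`, which is orthogonal to `γ'`. Covariant differentiation sends the lift of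
`y` to the lift of `y'`, and the curvature term is the lift of `A y`, so the Jacobi equation for
such fields is `y'' + A y = 0` (`IsNewtonPair.isJacobiFieldOn`). Conjugate points thus come from a
nonzero solution of this linear system vanishing at two times. Here `A` is continuous and symmetric,
its trace `ΔV` is nonnegative, and `A t₀ ≠ 0`.

Such a solution exists (`exists_conjugate_points`). Let `D` be the operator solution with `D = 0`,
`D' = 1` at a time far in the past. If `D` becomes singular later, a kernel vector gives the
solution. Otherwise `S = D' D⁻¹` is a symmetric solution of `S' = -A - S²`. Completing the square
shows that, for test fields `y_k`, the quantity `∑ ⟪S y_k, y_k⟫` grows over an interval by at most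
`∫ ∑ (|y_k'|² - ⟪A y_k, y_k⟫)`. Linear ramps times an orthonormal basis give `tr S ≤ n / L` at time
`L` after the start of an interval and `tr S ≥ -n / L` at time `L` before its end. The fields `e_k +
η ψ A(t₀) e_k`, with a bump `ψ`, force `tr S` to drop across a neighbourhood of `t₀` by an amount
not depending on `S`, even when `A` is trace free. For large `L` these bounds contradict each other.

The family of solutions has initial velocities `x'(t₁) + s p(t₁)`, where `p = y'`. It comes from the
inverse function theorem in `C([t₁, t₂])`, applied to the integral form of the equation: its
linearization is the identity minus a Volterra operator, hence invertible
(`exists_contDiffAt_solution_map`). The `v` coordinate is the integral of `V - |x'|² / 2`, and the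
first variation formula identifies its derivative in `s` as `-⟪x', y⟫`. -/

open Set Filter Topology

set_option linter.unusedSectionVars false

/-! ### Superposition operators on spaces of continuous functions. -/

section Superposition

variable {X Z F : Type*} [TopologicalSpace X] [CompactSpace X] [LocallyCompactSpace X]
  [NormedAddCommGroup Z] [NormedSpace ℝ Z] [NormedAddCommGroup F] [NormedSpace ℝ F]

/-- Pointwise application of a continuous family of continuous linear maps to a continuous
function, as a continuous bilinear map. -/
noncomputable def pointwiseApply : C(X, Z →L[ℝ] F) →L[ℝ] C(X, Z) →L[ℝ] C(X, F) :=
  LinearMap.mkContinuous₂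
    (LinearMap.mk₂ ℝ (fun (M : C(X, Z →L[ℝ] F)) (u : C(X, Z)) =>
        (⟨fun x => M x (u x), M.continuous.clm_apply u.continuous⟩ : C(X, F)))
      (fun _ _ _ => by ext; simp) (fun _ _ _ => by ext; simp)
      (fun _ _ _ => by ext; simp) (fun _ _ _ => by ext; simp)) 1 (fun M u => by
        rw [ContinuousMap.norm_le _ (by positivity), one_mul]
        intro x
        exact (M x).le_of_opNorm_le_of_le (M.norm_coe_le_norm x) (u.norm_coe_le_norm x))

@[simp]
theorem pointwiseApply_apply (M : C(X, Z →L[ℝ] F)) (u : C(X, Z)) (x : X) :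
    pointwiseApply M u x = M x (u x) := rfl

/-- The superposition operator `u ↦ (x ↦ f x (u x))`. -/
def superposition (f : C(X × Z, F)) (u : C(X, Z)) : C(X, F) :=
  f.comp ((ContinuousMap.id X).prodMk u)

@[simp]
theorem superposition_apply (f : C(X × Z, F)) (u : C(X, Z)) (x : X) :
    superposition f u x = f (x, u x) := rfl

theorem continuous_superposition (f : C(X × Z, F)) : Continuous (superposition f) := by
  refine ContinuousMap.continuous_of_continuous_uncurry _ ?_
  exact f.continuous.comp (continuous_snd.prodMk continuous_eval)

/-- The mean value inequality is applied at each `x`. Uniformity in `x` comes from continuity of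
`superposition f'` in the sup norm, so `Z` need not be locally compact. -/
theorem hasFDerivAt_superposition (f : C(X × Z, F)) (f' : C(X × Z, Z →L[ℝ] F))
    (h : ∀ x z, HasFDerivAt (fun z => f (x, z)) (f' (x, z)) z) (u : C(X, Z)) :
    HasFDerivAt (superposition f) (pointwiseApply (superposition f' u)) u := by
  rw [hasFDerivAt_iff_isLittleO, Asymptotics.isLittleO_iff]
  intro ε hε
  obtain ⟨δ, hδ, H⟩ := Metric.continuousAt_iff.1 (continuous_superposition f').continuousAt ε hε
  filter_upwards [Metric.ball_mem_nhds u hδ] with w hw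
  rw [ContinuousMap.norm_le _ (by positivity)]
  intro x
  have key : ‖f (x, w x) - f (x, u x) - f' (x, u x) (w x - u x)‖ ≤ ε * ‖w x - u x‖ := by
    refine Convex.norm_image_sub_le_of_norm_hasFDerivWithin_le' (s := segment ℝ (u x) (w x))
      (f := fun z => f (x, z)) (f' := fun z => f' (x, z))
      (fun z _ => (h x z).hasFDerivWithinAt) ?_ (convex_segment _ _)
      (left_mem_segment _ _ _) (right_mem_segment _ _ _)
    intro z hz
    rw [segment_eq_image'] at hz
    obtain ⟨θ, hθ, rfl⟩ := hz
    -- A point of the segment in `Z` is the value at `x` of a function on the segment from `u` to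
    -- `w`, and that function stays in the `δ`-ball.
    have hd : dist (u + θ • (w - u)) u < δ := by
      rw [dist_eq_norm, add_sub_cancel_left, norm_smul, Real.norm_of_nonneg hθ.1]
      refine lt_of_le_of_lt (mul_le_of_le_one_left (norm_nonneg _) hθ.2) ?_
      rwa [← dist_eq_norm]
    have h2 := (H hd).le
    rw [dist_eq_norm] at h2
    simpa using (ContinuousMap.norm_coe_le_norm
      (superposition f' (u + θ • (w - u)) - superposition f' u) x).trans h2
  refine le_trans (b := ε * ‖w x - u x‖) (by simpa using key) ?_
  gcongr
  exact ContinuousMap.norm_coe_le_norm (w - u) x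

theorem contDiff_superposition (f : C(X × Z, F)) (f' : C(X × Z, Z →L[ℝ] F))
    (h : ∀ x z, HasFDerivAt (fun z => f (x, z)) (f' (x, z)) z) :
    ContDiff ℝ 1 (superposition f) := by
  rw [contDiff_one_iff_fderiv]
  refine ⟨fun u => (hasFDerivAt_superposition f f' h u).differentiableAt, ?_⟩
  rw [funext fun u => (hasFDerivAt_superposition f f' h u).fderiv]
  exact pointwiseApply.continuous.comp (continuous_superposition f')

end Superposition

/-! ### Primitives and Volterra operators. -/

section Volterra

variable {Z : Type*} [NormedAddCommGroup Z] [NormedSpace ℝ Z] {a b : ℝ}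

/-- The primitive `∫_a^t u` of a continuous function on `[a, b]`, extended by constants. -/
noncomputable def primitiveIcc (hab : a ≤ b) (u : C(Icc a b, Z)) (t : ℝ) : Z :=
  ∫ σ in a..t, IccExtend hab u σ

theorem continuous_IccExtend_continuousMap (hab : a ≤ b) (u : C(Icc a b, Z)) :
    Continuous (IccExtend hab u) :=
  u.continuous.Icc_extend'

@[simp]
theorem primitiveIcc_left (hab : a ≤ b) (u : C(Icc a b, Z)) : primitiveIcc hab u a = 0 := by
  simp [primitiveIcc]

theorem norm_IccExtend_le (hab : a ≤ b) (u : C(Icc a b, Z)) (t : ℝ) :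
    ‖IccExtend hab u t‖ ≤ ‖u‖ :=
  u.norm_coe_le_norm _

theorem norm_primitiveIcc_sub_le (hab : a ≤ b) (u : C(Icc a b, Z)) (s t : ℝ) :
    ‖primitiveIcc hab u t - primitiveIcc hab u s‖ ≤ ‖u‖ * |t - s| := by
  have hi := (continuous_IccExtend_continuousMap hab u).intervalIntegrable (μ := MeasureTheory.volume)
  rw [primitiveIcc, primitiveIcc, intervalIntegral.integral_interval_sub_left (hi _ _) (hi _ _)]
  exact intervalIntegral.norm_integral_le_of_norm_le_const fun σ _ => norm_IccExtend_le hab u σ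

theorem norm_primitiveIcc_le (hab : a ≤ b) (u : C(Icc a b, Z)) (t : ℝ) :
    ‖primitiveIcc hab u t‖ ≤ ‖u‖ * |t - a| := by
  simpa using norm_primitiveIcc_sub_le hab u a t

theorem hasDerivAt_primitiveIcc [CompleteSpace Z] (hab : a ≤ b) (u : C(Icc a b, Z)) (t : ℝ) :
    HasDerivAt (primitiveIcc hab u) (IccExtend hab u t) t := by
  have hc := continuous_IccExtend_continuousMap hab u
  exact intervalIntegral.integral_hasDerivAt_right (hc.intervalIntegrable _ _)
    (hc.stronglyMeasurableAtFilter _ _) hc.continuousAt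

/-- `primitiveIcc` at a fixed time as a continuous linear map. -/
noncomputable def primitiveIccCLM (hab : a ≤ b) (t : ℝ) : C(Icc a b, Z) →L[ℝ] Z :=
  LinearMap.mkContinuous
    { toFun := fun u => primitiveIcc hab u t
      map_add' := fun u w => by
        simp only [primitiveIcc]
        rw [← intervalIntegral.integral_add
          ((continuous_IccExtend_continuousMap hab u).intervalIntegrable _ _)
          ((continuous_IccExtend_continuousMap hab w).intervalIntegrable _ _)]
        rfl
      map_smul' := fun c u => by
        simp only [primitiveIcc, RingHom.id_apply]
        rw [← intervalIntegral.integral_smul]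
        rfl } |t - a| (fun u => by
          rw [mul_comm]
          exact norm_primitiveIcc_le hab u t)

@[simp]
theorem primitiveIccCLM_apply (hab : a ≤ b) (t : ℝ) (u : C(Icc a b, Z)) :
    primitiveIccCLM hab t u = primitiveIcc hab u t := rfl

/-- The primitive is linear in `u` with derivative `u t` in `t`. Both partial derivatives are
jointly continuous: the first is Lipschitz in `t` in operator norm, the second is evaluation. -/
theorem contDiff_primitiveIcc [CompleteSpace Z] (hab : a ≤ b) :
    ContDiff ℝ 1 (fun q : C(Icc a b, Z) × ℝ => primitiveIcc hab q.1 q.2) := by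
  have c1 : Continuous (fun q : C(Icc a b, Z) × ℝ => primitiveIccCLM (Z := Z) hab q.2) := by
    have : LipschitzWith 1 (primitiveIccCLM (Z := Z) hab) := by
      refine LipschitzWith.of_dist_le_mul fun s t => ?_
      rw [dist_eq_norm, dist_eq_norm]
      refine ContinuousLinearMap.opNorm_le_bound _ (by positivity) fun u => ?_
      have := norm_primitiveIcc_sub_le hab u t s
      simpa [mul_comm] using this
    exact this.continuous.comp continuous_snd
  have c2 : Continuous (fun q : C(Icc a b, Z) × ℝ =>
      ContinuousLinearMap.toSpanSingleton ℝ (IccExtend hab q.1 q.2)) := by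
    refine (ContinuousLinearMap.toSpanSingletonCLE (𝕜 := ℝ) (E := Z)).continuous.comp ?_
    exact continuous_eval.comp
      (continuous_fst.prodMk ((continuous_projIcc (h := hab)).comp continuous_snd))
  have key : ∀ q : C(Icc a b, Z) × ℝ, HasFDerivAt
      (fun q : C(Icc a b, Z) × ℝ => primitiveIcc hab q.1 q.2)
      ((primitiveIccCLM hab q.2).coprod
        (ContinuousLinearMap.toSpanSingleton ℝ (IccExtend hab q.1 q.2))) q := fun q =>
    (hasStrictFDerivAt_uncurry_coprod (f := fun (u : C(Icc a b, Z)) (t : ℝ) => primitiveIcc hab u t)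
      (f₁ := fun _ t => primitiveIccCLM hab t)
      (f₂ := fun u t => ContinuousLinearMap.toSpanSingleton ℝ (IccExtend hab u t))
      (Eventually.of_forall fun v => (primitiveIccCLM (Z := Z) hab v.2).hasFDerivAt (x := v.1))
      (Eventually.of_forall fun v => (hasDerivAt_primitiveIcc hab v.1 v.2).hasFDerivAt)
      c1.continuousAt c2.continuousAt).hasFDerivAt
  rw [contDiff_one_iff_fderiv]
  refine ⟨fun q => (key q).differentiableAt, ?_⟩
  rw [funext fun q => (key q).fderiv]
  exact (ContinuousLinearMap.coprodEquivL ℝ).continuous.comp (c1.prodMk c2)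

/-- The Volterra operator `u ↦ (t ↦ ∫_a^t u)` on `C([a, b], Z)`. -/
noncomputable def volterra [CompleteSpace Z] (hab : a ≤ b) :
    C(Icc a b, Z) →L[ℝ] C(Icc a b, Z) :=
  LinearMap.mkContinuous
    { toFun := fun u => ⟨fun t => primitiveIcc hab u t,
        (continuous_iff_continuousAt.2 fun t =>
          (hasDerivAt_primitiveIcc hab u t).continuousAt).comp continuous_subtype_val⟩
      map_add' := fun u w => by
        ext t
        exact (primitiveIccCLM hab (t : ℝ)).map_add u w
      map_smul' := fun c u => by
        ext t
        exact (primitiveIccCLM hab (t : ℝ)).map_smul c u } (b - a) (fun u => by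
      rw [ContinuousMap.norm_le _ (mul_nonneg (sub_nonneg.2 hab) (norm_nonneg _))]
      intro t
      refine (norm_primitiveIcc_le hab u t).trans ?_
      rw [mul_comm, abs_of_nonneg (sub_nonneg.2 t.2.1)]
      gcongr
      exact t.2.2)

@[simp]
theorem volterra_apply [CompleteSpace Z] (hab : a ≤ b) (u : C(Icc a b, Z)) (t : Icc a b) :
    volterra hab u t = primitiveIcc hab u t := rfl

/-- The factorial comes from integrating `(σ - a) ^ m` once more at each step; it makes the operator
quasinilpotent on an interval of any length. -/
theorem norm_volterra_pow_apply_le [CompleteSpace Z] (hab : a ≤ b) (M : C(Icc a b, Z →L[ℝ] Z))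
    (u : C(Icc a b, Z)) (m : ℕ) (t : Icc a b) :
    ‖((volterra hab ∘L pointwiseApply M) ^ m) u t‖ ≤
      ‖M‖ ^ m * ((t : ℝ) - a) ^ m / m.factorial * ‖u‖ := by
  induction m generalizing t with
  | zero => simpa using u.norm_coe_le_norm t
  | succ m ih =>
    rw [pow_succ']
    set w := ((volterra hab ∘L pointwiseApply M) ^ m) u with hw
    change ‖primitiveIcc hab (pointwiseApply M w) t‖ ≤ _
    have hle : ∀ σ ∈ Ioc a (t : ℝ), ‖IccExtend hab (pointwiseApply M w) σ‖ ≤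
        ‖M‖ * (‖M‖ ^ m * (σ - a) ^ m / m.factorial * ‖u‖) := by
      intro σ hσ
      have hσ' : σ ∈ Icc a b := ⟨hσ.1.le, hσ.2.trans t.2.2⟩
      rw [IccExtend_of_mem hab _ hσ', pointwiseApply_apply]
      exact (M _).le_of_opNorm_le_of_le (M.norm_coe_le_norm _) (ih ⟨σ, hσ'⟩)
    refine (intervalIntegral.norm_integral_le_of_norm_le t.2.1
      (Eventually.of_forall hle) (Continuous.intervalIntegrable (by fun_prop) _ _)).trans_eq ?_
    have hint : ∫ σ in a..(t : ℝ), (σ - a) ^ m = ((t : ℝ) - a) ^ (m + 1) / (m + 1) := by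
      rw [intervalIntegral.integral_comp_sub_right (fun σ => σ ^ m) a, integral_pow]
      simp
    have : ∀ σ : ℝ, ‖M‖ * (‖M‖ ^ m * (σ - a) ^ m / m.factorial * ‖u‖) =
        (‖M‖ ^ (m + 1) / m.factorial * ‖u‖) * (σ - a) ^ m := fun σ => by ring
    simp_rw [this]
    rw [intervalIntegral.integral_const_mul, hint, Nat.factorial_succ]
    push_cast
    field_simp

/-- Some power `K ^ m` has norm less than one, so `1 - K ^ m` is a unit. It factors as a geometric
sum times `1 - K`; these commute, so `1 - K` is a unit too. -/
theorem isUnit_one_sub_volterra [CompleteSpace Z] (hab : a ≤ b) (M : C(Icc a b, Z →L[ℝ] Z)) :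
    IsUnit (1 - volterra hab ∘L pointwiseApply M) := by
  set K := volterra hab ∘L pointwiseApply M with hK
  obtain ⟨m, hm⟩ : ∃ m : ℕ, (‖M‖ * (b - a)) ^ m / m.factorial < 1 :=
    ((FloorSemiring.tendsto_pow_div_factorial_atTop (‖M‖ * (b - a))).eventually_lt_const
      one_pos).exists
  have hn : ‖K ^ m‖ < 1 := by
    refine lt_of_le_of_lt (ContinuousLinearMap.opNorm_le_bound _ ?_ fun u => ?_) hm
    · have := sub_nonneg.2 hab
      positivity
    · rw [ContinuousMap.norm_le _ (by have := sub_nonneg.2 hab; positivity)]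
      intro t
      refine (norm_volterra_pow_apply_le hab M u m t).trans ?_
      rw [mul_pow]
      have := sub_nonneg.2 t.2.1
      gcongr
      exact t.2.2
  have h1 : IsUnit (1 - K ^ m) := isUnit_one_sub_of_norm_lt_one (x := K ^ m) hn
  have hc : Commute (∑ i ∈ Finset.range m, K ^ i) (1 - K) :=
    (Commute.one_right _).sub_right (Finset.sum_induction _ (fun y => Commute y K)
      (fun _ _ h h' => h.add_left h') (Commute.zero_left _)
      fun i _ => (Commute.refl K).pow_left i)
  rw [← geom_sum_mul_neg] at h1
  exact (hc.isUnit_mul_iff.1 h1).2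

end Volterra

/-! ### Linear equations and smooth dependence on initial values. -/

section ODE

variable {Z : Type*} [NormedAddCommGroup Z] [NormedSpace ℝ Z] {a b : ℝ}

/-- Constant functions as a continuous linear map. -/
noncomputable def constantMapCLM (X Z : Type*) [TopologicalSpace X] [CompactSpace X]
    [NormedAddCommGroup Z] [NormedSpace ℝ Z] : Z →L[ℝ] C(X, Z) :=
  LinearMap.mkContinuous
    { toFun := ContinuousMap.const X
      map_add' := fun _ _ => rfl
      map_smul' := fun _ _ => rfl } 1 (fun z => by
        rw [one_mul]
        exact (ContinuousMap.norm_le _ (norm_nonneg _)).2 fun _ => le_rfl)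

@[simp]
theorem constantMapCLM_apply (X : Type*) [TopologicalSpace X] [CompactSpace X] (z : Z) (x : X) :
    constantMapCLM X Z z x = z := rfl

/-- Together with `hasDerivWithinAt_IccExtend`, this is the passage between a differential equation
on `[a, b]` and a fixed point equation in `C([a, b], Z)`. -/
theorem eq_add_primitiveIcc [CompleteSpace Z] (hab : a ≤ b) {z : ℝ → Z} {w : C(Icc a b, Z)}
    (hz : ∀ t (ht : t ∈ Icc a b), HasDerivWithinAt z (w ⟨t, ht⟩) (Icc a b) t)
    {t : ℝ} (ht : t ∈ Icc a b) : z t = z a + primitiveIcc hab w t := by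
  have hd : ∀ s ∈ Icc a b,
      HasDerivWithinAt (fun s => z s - primitiveIcc hab w s) 0 (Icc a b) s := fun s hs => by
    have := (hz s hs).sub (hasDerivAt_primitiveIcc hab w s).hasDerivWithinAt
    rwa [IccExtend_of_mem hab _ hs, sub_self] at this
  have := (convex_Icc a b).norm_image_sub_le_of_norm_hasDerivWithin_le (C := 0) hd (by simp)
    (left_mem_Icc.2 hab) ht
  rw [zero_mul, norm_le_zero_iff, primitiveIcc_left, sub_zero, sub_eq_zero] at this
  exact (sub_eq_iff_eq_add.1 this)

theorem hasDerivWithinAt_IccExtend [CompleteSpace Z] (hab : a ≤ b) {u w : C(Icc a b, Z)} {ζ : Z}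
    (hu : u = constantMapCLM _ Z ζ + volterra hab w) {t : ℝ} (ht : t ∈ Icc a b) :
    HasDerivWithinAt (IccExtend hab u) (w ⟨t, ht⟩) (Icc a b) t := by
  have hd : HasDerivWithinAt (fun s => ζ + primitiveIcc hab w s) (w ⟨t, ht⟩) (Icc a b) t := by
    have := ((hasDerivAt_primitiveIcc hab w t).const_add ζ).hasDerivWithinAt (s := Icc a b)
    rwa [IccExtend_of_mem hab _ ht] at this
  have heq : ∀ s ∈ Icc a b, IccExtend hab u s = ζ + primitiveIcc hab w s := fun s hs => by
    rw [IccExtend_of_mem hab _ hs, hu]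
    rfl
  exact hd.congr heq (heq t ht)

theorem IccExtend_left_eq [CompleteSpace Z] (hab : a ≤ b) {u w : C(Icc a b, Z)} {ζ : Z}
    (hu : u = constantMapCLM _ Z ζ + volterra hab w) : IccExtend hab u a = ζ := by
  rw [IccExtend_of_mem hab _ (left_mem_Icc.2 hab), hu]
  simp

/-- Linear differential equations have global solutions. -/
theorem exists_linear_ode_solution [CompleteSpace Z] (hab : a ≤ b) {A : ℝ → Z →L[ℝ] Z}
    (hA : ContinuousOn A (Icc a b)) (ζ : Z) :
    ∃ z : ℝ → Z, z a = ζ ∧ ∀ t ∈ Icc a b, HasDerivWithinAt z (A t (z t)) (Icc a b) t := by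
  set M : C(Icc a b, Z →L[ℝ] Z) := ⟨fun t => A t, continuousOn_iff_continuous_domRestrict.1 hA⟩
  obtain ⟨e, he⟩ := isUnit_one_sub_volterra hab M
  set u : C(Icc a b, Z) := (↑e⁻¹ : C(Icc a b, Z) →L[ℝ] C(Icc a b, Z)) (constantMapCLM _ Z ζ)
  have hu : u = constantMapCLM _ Z ζ + volterra hab (pointwiseApply M u) := by
    have h1 : (1 - volterra hab ∘L pointwiseApply M) u = constantMapCLM _ Z ζ := by
      rw [← he]
      exact DFunLike.congr_fun (e.mul_inv) (constantMapCLM _ Z ζ)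
    rw [← h1]
    simp
  refine ⟨IccExtend hab u, IccExtend_left_eq hab hu, fun t ht => ?_⟩
  have := hasDerivWithinAt_IccExtend hab hu ht
  rw [IccExtend_of_mem hab _ ht]
  exact this

/-- The solutions of a `C¹` differential equation near a given one are a `C¹` function of the
initial value, with respect to the uniform norm. -/
theorem exists_contDiffAt_solution_map [CompleteSpace Z] (hab : a ≤ b)
    (f : C(Icc a b × Z, Z)) (f' : C(Icc a b × Z, Z →L[ℝ] Z))
    (h : ∀ t z, HasFDerivAt (fun z => f (t, z)) (f' (t, z)) z) (u₀ : C(Icc a b, Z)) (ζ₀ : Z)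
    (hu₀ : u₀ = constantMapCLM _ Z ζ₀ + volterra hab (superposition f u₀)) :
    ∃ Φ : Z → C(Icc a b, Z), ContDiffAt ℝ 1 Φ ζ₀ ∧ Φ ζ₀ = u₀ ∧
      (∀ᶠ ζ in 𝓝 ζ₀, Φ ζ = constantMapCLM _ Z ζ + volterra hab (superposition f (Φ ζ))) ∧
      ∀ w y, y = constantMapCLM _ Z w + volterra hab (pointwiseApply (superposition f' u₀) y) →
        fderiv ℝ Φ ζ₀ w = y := by
  obtain ⟨e, he⟩ := isUnit_one_sub_volterra hab (superposition f' u₀)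
  set E : C(Icc a b, Z) ≃L[ℝ] C(Icc a b, Z) := ContinuousLinearEquiv.ofUnit e with hE
  have hEapp : ∀ u, E u = u - volterra hab (pointwiseApply (superposition f' u₀) u) := fun u => by
    change (e : C(Icc a b, Z) →L[ℝ] C(Icc a b, Z)) u = _
    rw [he]
    simp
  -- The integral equation with initial value `ζ` reads `Ψ u = const ζ`. The derivative of `Ψ` at
  -- `u₀` is the isomorphism `E`, so the solution map is the local inverse of `Ψ` on constants.
  set Ψ : C(Icc a b, Z) → C(Icc a b, Z) := fun u => u - volterra hab (superposition f u) with hΨ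
  have hΨc : ContDiff ℝ 1 Ψ :=
    contDiff_id.sub (ContDiff.comp (g := volterra (Z := Z) hab) (ContinuousLinearMap.contDiff _)
      (contDiff_superposition f f' h))
  have hΨd : HasFDerivAt Ψ (E : C(Icc a b, Z) →L[ℝ] C(Icc a b, Z)) u₀ := by
    have := (hasFDerivAt_id u₀).sub
      ((volterra hab).hasFDerivAt.comp u₀ (hasFDerivAt_superposition f f' h u₀))
    have hE' : (E : C(Icc a b, Z) →L[ℝ] C(Icc a b, Z)) = ContinuousLinearMap.id ℝ _ -
        volterra hab ∘L pointwiseApply (superposition f' u₀) := by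
      ext1 u
      exact hEapp u
    rw [hE']
    exact this
  set g := hΨc.contDiffAt.localInverse hΨd one_ne_zero with hg
  have hΨ₀ : Ψ u₀ = constantMapCLM _ Z ζ₀ := sub_eq_iff_eq_add.2 hu₀
  have hgc : ContDiffAt ℝ 1 g (constantMapCLM _ Z ζ₀) := by
    rw [← hΨ₀]
    exact hΨc.contDiffAt.to_localInverse hΨd one_ne_zero
  have hstrict := hΨc.contDiffAt.hasStrictFDerivAt' hΨd one_ne_zero
  have hright : ∀ᶠ v in 𝓝 (constantMapCLM (Icc a b) Z ζ₀), Ψ (g v) = v := by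
    rw [← hΨ₀]
    exact hstrict.eventually_right_inverse
  have hg₀ : g (constantMapCLM _ Z ζ₀) = u₀ := by
    rw [← hΨ₀]
    exact hstrict.localInverse_apply_image
  have hgd : HasFDerivAt g (E.symm : C(Icc a b, Z) →L[ℝ] C(Icc a b, Z))
      (constantMapCLM _ Z ζ₀) := by
    rw [← hΨ₀]
    exact hstrict.to_localInverse.hasFDerivAt
  refine ⟨fun ζ => g (constantMapCLM _ Z ζ), ?_, hg₀, ?_, ?_⟩
  · exact ContDiffAt.comp (f := constantMapCLM (Icc a b) Z) ζ₀ hgc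
      (ContinuousLinearMap.contDiff _).contDiffAt
  · filter_upwards [(constantMapCLM (Icc a b) Z).continuous.continuousAt.eventually hright]
      with ζ hζ
    exact sub_eq_iff_eq_add.1 hζ
  · intro w y hy
    have hd := hgd.comp ζ₀ (constantMapCLM (Icc a b) Z).hasFDerivAt
    have : fderiv ℝ (fun ζ => g (constantMapCLM _ Z ζ)) ζ₀ w = E.symm (constantMapCLM _ Z w) := by
      rw [show (fun ζ => g (constantMapCLM _ Z ζ)) = g ∘ constantMapCLM _ Z from rfl, hd.fderiv]
      rfl
    rw [this, ContinuousLinearEquiv.symm_apply_eq, hEapp]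
    exact eq_sub_iff_add_eq.2 hy.symm

end ODE

/-! ### Conjugate points of `y'' + A y = 0` by the Riccati equation. -/

section Riccati

open scoped RealInnerProductSpace

variable {E : Type*} [NormedAddCommGroup E] [InnerProductSpace ℝ E]

/-- `y` solves the linear second order equation `y'' + A y = 0` on `I`, with `y' = p`. -/
def IsLinearNewtonSolution (A : ℝ → E →L[ℝ] E) (I : Set ℝ) (y p : ℝ → E) : Prop :=
  ∀ t ∈ I, HasDerivWithinAt y (p t) I t ∧ HasDerivWithinAt p (-A t (y t)) I t

theorem IsLinearNewtonSolution.mono {A : ℝ → E →L[ℝ] E} {I I' : Set ℝ} {y p : ℝ → E}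
    (h : IsLinearNewtonSolution A I y p) (hI : I' ⊆ I) : IsLinearNewtonSolution A I' y p :=
  fun t ht => ⟨(h t (hI ht)).1.mono hI, (h t (hI ht)).2.mono hI⟩

/-- The equation is solved for operators rather than vectors, as the first order linear system `(D,
P)' = (P, -A D)`. -/
theorem exists_fundamental_solution [CompleteSpace E] {A : ℝ → E →L[ℝ] E} (hA : Continuous A)
    {a b : ℝ} (hab : a ≤ b) :
    ∃ D P : ℝ → E →L[ℝ] E, D a = 0 ∧ P a = 1 ∧ ∀ t ∈ Icc a b,
      HasDerivWithinAt D (P t) (Icc a b) t ∧ HasDerivWithinAt P (-(A t * D t)) (Icc a b) t := by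
  set Q : ℝ → ((E →L[ℝ] E) × (E →L[ℝ] E)) →L[ℝ] ((E →L[ℝ] E) × (E →L[ℝ] E)) := fun t =>
    (ContinuousLinearMap.inl ℝ (E →L[ℝ] E) (E →L[ℝ] E)).comp (ContinuousLinearMap.snd ℝ _ _) -
      (ContinuousLinearMap.inr ℝ (E →L[ℝ] E) (E →L[ℝ] E)).comp
        ((ContinuousLinearMap.compL ℝ E E E (A t)).comp (ContinuousLinearMap.fst ℝ _ _)) with hQ
  have hQc : Continuous Q :=
    continuous_const.sub (continuous_const.clm_comp
      (((ContinuousLinearMap.compL ℝ E E E).continuous.comp hA).clm_comp continuous_const))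
  obtain ⟨z, hza, hz⟩ := exists_linear_ode_solution hab hQc.continuousOn
    ((0, 1) : (E →L[ℝ] E) × (E →L[ℝ] E))
  refine ⟨fun t => (z t).1, fun t => (z t).2, by simp [hza], by simp [hza], fun t ht => ?_⟩
  have h1 := (ContinuousLinearMap.fst ℝ (E →L[ℝ] E) (E →L[ℝ] E)).hasFDerivAt.comp_hasDerivWithinAt
    t (hz t ht)
  have h2 := (ContinuousLinearMap.snd ℝ (E →L[ℝ] E) (E →L[ℝ] E)).hasFDerivAt.comp_hasDerivWithinAt
    t (hz t ht)
  refine ⟨h1.congr_deriv ?_, h2.congr_deriv ?_⟩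
  · simp [hQ]
  · simp [hQ]
    rfl

/-- Symmetry of `A` makes the Wronskian constant, and it vanishes at `a`. -/
theorem wronskian_eq_zero {A : ℝ → E →L[ℝ] E} (hsym : ∀ t u w, ⟪A t u, w⟫ = ⟪u, A t w⟫)
    {a b : ℝ} {y p z q : ℝ → E} (hy : IsLinearNewtonSolution A (Icc a b) y p)
    (hz : IsLinearNewtonSolution A (Icc a b) z q) (hya : y a = 0) (hza : z a = 0)
    {t : ℝ} (ht : t ∈ Icc a b) : ⟪p t, z t⟫ = ⟪y t, q t⟫ := by
  have hd : ∀ s ∈ Icc a b,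
      HasDerivWithinAt (fun s => ⟪p s, z s⟫ - ⟪y s, q s⟫) 0 (Icc a b) s := fun s hs => by
    have := ((hy s hs).2.inner ℝ (hz s hs).1).sub ((hy s hs).1.inner ℝ (hz s hs).2)
    refine this.congr_deriv ?_
    simp only [inner_neg_left, inner_neg_right, hsym]
    ring
  have := (convex_Icc a b).norm_image_sub_le_of_norm_hasDerivWithin_le (C := 0) hd (by simp)
    (left_mem_Icc.2 (ht.1.trans ht.2)) ht
  rw [zero_mul, norm_le_zero_iff, hya, hza, inner_zero_left, inner_zero_right, sub_zero,
    sub_zero, sub_eq_zero] at this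
  exact this

/-- Either there is a point conjugate to `a` in `(a, b]`, or the Riccati equation has a symmetric
solution on `(a, b]`. -/
theorem exists_conjugate_or_riccati [FiniteDimensional ℝ E] {A : ℝ → E →L[ℝ] E}
    (hA : Continuous A)
    (hsym : ∀ t u w, ⟪A t u, w⟫ = ⟪u, A t w⟫) {a c b : ℝ} (hac : a < c) (hcb : c ≤ b) :
    (∃ t₂, a < t₂ ∧ ∃ y p, IsLinearNewtonSolution A (Icc a t₂) y p ∧ y a = 0 ∧ y t₂ = 0 ∧
      p a ≠ 0) ∨
    ∃ S : ℝ → E →L[ℝ] E, ∀ t ∈ Icc c b,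
      HasDerivWithinAt S (-A t - S t * S t) (Icc c b) t ∧ ∀ u w, ⟪S t u, w⟫ = ⟪u, S t w⟫ := by
  have : CompleteSpace E := FiniteDimensional.complete ℝ E
  have hab : a ≤ b := hac.le.trans hcb
  obtain ⟨D, P, hDa, hPa, hDP⟩ := exists_fundamental_solution hA hab
  have hsol : ∀ w, IsLinearNewtonSolution A (Icc a b) (fun t => D t w) (fun t => P t w) :=
    fun w t ht => ⟨by simpa using (hDP t ht).1.clm_apply (hasDerivWithinAt_const t _ w),
      by simpa using (hDP t ht).2.clm_apply (hasDerivWithinAt_const t _ w)⟩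
  by_cases hinj : ∀ t ∈ Ioc a b, ∀ w, D t w = 0 → w = 0
  · right
    have hunit : ∀ t ∈ Ioc a b, IsUnit (D t) := fun t ht => by
      have hi : Function.Injective (D t : E →ₗ[ℝ] E) :=
        (injective_iff_map_eq_zero _).2 fun w hw => hinj t ht w hw
      exact ContinuousLinearMap.isUnit_iff_bijective.2
        ⟨hi, LinearMap.surjective_of_injective hi⟩
    have hsub : Icc c b ⊆ Icc a b := Icc_subset_Icc_left hac.le
    -- Since `P = D'`, differentiating `P D⁻¹` gives `-A D D⁻¹ - P D⁻¹ P D⁻¹ = -A - S²`.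
    refine ⟨fun t => P t * Ring.inverse (D t), fun t ht => ?_⟩
    obtain ⟨d, hd⟩ := hunit t ⟨hac.trans_le ht.1, ht.2⟩
    have hinv : Ring.inverse (D t) = ↑d⁻¹ := by rw [← hd, Ring.inverse_unit]
    constructor
    · have h1 : HasDerivWithinAt (fun t => Ring.inverse (D t))
          (-(↑d⁻¹ * P t * ↑d⁻¹)) (Icc c b) t := by
        have hF := hasFDerivAt_ringInverse (𝕜 := ℝ) d
        rw [hd] at hF
        exact hF.comp_hasDerivWithinAt t ((hDP t (hsub ht)).1.mono hsub)
      have h2 := ((hDP t (hsub ht)).2.mono hsub).mul h1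
      refine h2.congr_deriv ?_
      rw [hinv, ← hd, neg_mul, mul_assoc, Units.mul_inv, mul_one, mul_neg, sub_eq_add_neg]
      simp only [hinv, mul_assoc]
    · intro u w
      have hw : ∀ w, D t ((↑d⁻¹ : E →L[ℝ] E) w) = w := fun w => by
        rw [← hd]
        exact DFunLike.congr_fun d.mul_inv w
      -- The two solutions take the values `u` and `w` at time `t`, so the vanishing Wronskian is
      -- the symmetry of `P D⁻¹`.
      have := wronskian_eq_zero hsym (hsol ((↑d⁻¹ : E →L[ℝ] E) u)) (hsol ((↑d⁻¹ : E →L[ℝ] E) w))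
        (by simp [hDa]) (by simp [hDa]) (hsub ht)
      simp only [hw] at this
      simpa [hinv] using this
  · left
    push Not at hinj
    obtain ⟨t₂, ht₂, w, hw, hw0⟩ := hinj
    exact ⟨t₂, ht₂.1, _, _, (hsol w).mono (Icc_subset_Icc_right ht₂.2), by simp [hDa], hw,
      by simpa [hPa] using hw0⟩

variable {ι : Type*} [Fintype ι]

/-- The index form inequality obtained by completing the square with a solution `S` of the
Riccati equation. -/
theorem sum_inner_riccati_sub_le {A S : ℝ → E →L[ℝ] E} {c d : ℝ} (hcd : c ≤ d)
    (hS : ∀ t ∈ Icc c d, HasDerivWithinAt S (-A t - S t * S t) (Icc c d) t ∧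
      ∀ u w, ⟪S t u, w⟫ = ⟪u, S t w⟫)
    {y y' : ι → ℝ → E} (hy : ∀ k t, HasDerivAt (y k) (y' k t) t)
    {G g : ℝ → ℝ} (hG : ∀ t, HasDerivAt G (g t) t)
    (hle : ∀ t ∈ Icc c d, ∑ k, (⟪y' k t, y' k t⟫ - ⟪A t (y k t), y k t⟫) ≤ g t) :
    ∑ k, ⟪S d (y k d), y k d⟫ - ∑ k, ⟪S c (y k c), y k c⟫ ≤ G d - G c := by
  -- The Riccati equation and the symmetry of `S` give `⟪S y, y⟫' = |y'|² - ⟪A y, y⟫ - |S y - y'|²`.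
  have hder : ∀ t ∈ Icc c d, HasDerivWithinAt (fun t => ∑ k, ⟪S t (y k t), y k t⟫ - G t)
      (∑ k, (⟪y' k t, y' k t⟫ - ⟪A t (y k t), y k t⟫
        - ⟪S t (y k t) - y' k t, S t (y k t) - y' k t⟫) - g t) (Icc c d) t := by
    intro t ht
    refine (HasDerivWithinAt.fun_sum fun k _ => ?_).sub (hG t).hasDerivWithinAt
    have h1 := (hy k t).hasDerivWithinAt (s := Icc c d)
    have h2 := ((hS t ht).1.clm_apply h1).inner ℝ h1
    refine h2.congr_deriv ?_
    have hs := (hS t ht).2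
    have e1 : ⟪(S t * S t) (y k t), y k t⟫ = ⟪S t (y k t), S t (y k t)⟫ := hs _ _
    have e2 : ⟪S t (y' k t), y k t⟫ = ⟪S t (y k t), y' k t⟫ := by
      rw [hs, real_inner_comm]
    have e3 : ⟪y' k t, S t (y k t)⟫ = ⟪S t (y k t), y' k t⟫ := real_inner_comm _ _
    simp only [sub_apply, neg_apply,
      inner_add_left, inner_sub_left, inner_sub_right,
      inner_neg_left, e1, e2, e3]
    ring
  have hanti : AntitoneOn (fun t => ∑ k, ⟪S t (y k t), y k t⟫ - G t) (Icc c d) := by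
    refine antitoneOn_of_hasDerivWithinAt_nonpos (convex_Icc c d)
      (fun t ht => (hder t ht).continuousWithinAt)
      (fun t ht => (hder t (interior_subset ht)).mono interior_subset) fun t ht => ?_
    have h1 := hle t (interior_subset ht)
    have h2 : 0 ≤ ∑ k, ⟪S t (y k t) - y' k t, S t (y k t) - y' k t⟫ :=
      Finset.sum_nonneg fun k _ => real_inner_self_nonneg
    rw [Finset.sum_sub_distrib]
    linarith
  have := hanti (left_mem_Icc.2 hcd) (right_mem_Icc.2 hcd) hcd
  simp only at this
  linarith

/-- Where the potential is nonzero, the trace of a symmetric Riccati solution drops by a definite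
amount. -/
theorem sum_inner_riccati_drop {A : ℝ → E →L[ℝ] E} (hA : Continuous A)
    (hsym : ∀ t u w, ⟪A t u, w⟫ = ⟪u, A t w⟫) (e : OrthonormalBasis ι ℝ E)
    (htr : ∀ t, 0 ≤ ∑ k, ⟪A t (e k), e k⟫) {t₀ : ℝ} (h₀ : A t₀ ≠ 0) :
    ∃ δ > 0, ∃ m > 0, ∀ S : ℝ → E →L[ℝ] E,
      (∀ t ∈ Icc (t₀ - δ) (t₀ + δ),
        HasDerivWithinAt S (-A t - S t * S t) (Icc (t₀ - δ) (t₀ + δ)) t ∧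
        ∀ u w, ⟪S t u, w⟫ = ⟪u, S t w⟫) →
      ∑ k, ⟪S (t₀ + δ) (e k), e k⟫ - ∑ k, ⟪S (t₀ - δ) (e k), e k⟫ ≤ -m := by
  set B := A t₀ with hB
  -- The squared Hilbert–Schmidt norm of `A t₀`.
  set β : ℝ := ∑ k, ⟪B (e k), B (e k)⟫ with hβ
  have hβ0 : 0 < β := by
    obtain ⟨k, hk⟩ : ∃ k, B (e k) ≠ 0 := by
      by_contra! H
      refine h₀ (ContinuousLinearMap.coe_injective (e.toBasis.ext fun k => ?_))
      simpa using H k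
    exact Finset.sum_pos' (fun k _ => real_inner_self_nonneg)
      ⟨k, Finset.mem_univ k, real_inner_self_pos.2 hk⟩
  set r : ℝ → ℝ := fun t => ∑ k, ⟪A t (e k), B (e k)⟫ with hr
  set q : ℝ → ℝ := fun t => ∑ k, ⟪A t (B (e k)), B (e k)⟫ with hq
  have hrc : Continuous r := by fun_prop
  have hqc : Continuous q := by fun_prop
  have hr0 : r t₀ = β := rfl
  set M : ℝ := |q t₀| + 1 with hM
  have hM0 : 0 < M := by positivity
  have hev : ∀ᶠ t in 𝓝 t₀, β / 2 < r t ∧ -M < q t :=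
    (hrc.continuousAt.eventually_const_lt (by rw [hr0]; linarith)).and
      (hqc.continuousAt.eventually_const_lt (by have := neg_abs_le (q t₀); linarith))
  obtain ⟨δ, hδ, hball⟩ := Metric.nhds_basis_closedBall.eventually_iff.1 hev
  have hrq : ∀ t ∈ Icc (t₀ - δ) (t₀ + δ), β / 2 < r t ∧ -M < q t := fun t ht =>
    hball (by rwa [Real.closedBall_eq_Icc])
  set K : ℝ := 4 * δ ^ 2 * β + δ ^ 4 * M with hK
  have hK0 : 0 < K := by positivity
  -- The total bound is `-(4/3) β δ³ η + 2 K δ η²`; this `η` minimizes it, with value `-(2/3) η β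
  -- δ³`.
  set η : ℝ := β * δ ^ 2 / (3 * K) with hη
  have hη0 : 0 < η := by positivity
  refine ⟨δ, hδ, 2 / 3 * η * β * δ ^ 3, by positivity, fun S hS => ?_⟩
  have hψ : ∀ t : ℝ, HasDerivAt (fun t => η * (δ ^ 2 - (t - t₀) ^ 2)) (η * (-(2 * (t - t₀)))) t :=
    fun t => by
      have := ((((hasDerivAt_id t).sub_const t₀).pow 2).const_sub (δ ^ 2)).const_mul η
      refine this.congr_deriv ?_
      simp
  have hG : ∀ t : ℝ, HasDerivAt
      (fun t => -(η * β) * (δ ^ 2 * (t - t₀) - (t - t₀) ^ 3 / 3) + η ^ 2 * K * (t - t₀))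
      (-(η * β) * (δ ^ 2 - (t - t₀) ^ 2) + η ^ 2 * K) t := fun t => by
    have h1 := (hasDerivAt_id t).sub_const t₀
    have := (((h1.const_mul (δ ^ 2)).sub ((h1.pow 3).div_const 3)).const_mul (-(η * β))).add
      (h1.const_mul (η ^ 2 * K))
    refine this.congr_deriv ?_
    simp
  -- The bump vanishes at both ends, so the boundary terms are the traces of `S`. The term of first
  -- order in `η` is `-2 η ψ r`, with `r` near `β > 0`; everything of second order is absorbed in
  -- `η² K`.
  have key := sum_inner_riccati_sub_le (by linarith) hS
    (y := fun k t => e k + (η * (δ ^ 2 - (t - t₀) ^ 2)) • B (e k))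
    (y' := fun k t => (η * (-(2 * (t - t₀)))) • B (e k))
    (fun k t => ((hψ t).smul_const (B (e k))).const_add (e k)) hG ?_
  · have e1 : η * (δ ^ 2 - (t₀ + δ - t₀) ^ 2) = 0 := by ring
    have e2 : η * (δ ^ 2 - (t₀ - δ - t₀) ^ 2) = 0 := by ring
    simp only [e1, e2, zero_smul, add_zero] at key
    refine key.trans_eq ?_
    have hKη : η * K = β * δ ^ 2 / 3 := by rw [hη]; field_simp
    linear_combination (2 * η * δ) * hKη
  · intro t ht
    obtain ⟨hrt, hqt⟩ := hrq t ht
    set τ := t - t₀ with hτ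
    have hτ1 : τ ^ 2 ≤ δ ^ 2 := sq_le_sq' (by linarith [ht.1]) (by linarith [ht.2])
    set ψ := δ ^ 2 - τ ^ 2 with hψd
    have hψ0 : 0 ≤ ψ := sub_nonneg.2 hτ1
    have hψ1 : ψ ≤ δ ^ 2 := by linarith [sq_nonneg τ]
    have hsum : ∑ k, (⟪(η * (-(2 * τ))) • B (e k), (η * (-(2 * τ))) • B (e k)⟫ -
        ⟪A t (e k + (η * ψ) • B (e k)), e k + (η * ψ) • B (e k)⟫) =
        4 * η ^ 2 * τ ^ 2 * β - (∑ k, ⟪A t (e k), e k⟫ + 2 * (η * ψ) * r t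
          + (η * ψ) ^ 2 * q t) := by
      simp only [hβ, hr, hq, Finset.mul_sum, ← Finset.sum_add_distrib, ← Finset.sum_sub_distrib]
      refine Finset.sum_congr rfl fun k _ => ?_
      have hs : ⟪A t (B (e k)), e k⟫ = ⟪A t (e k), B (e k)⟫ := by
        rw [hsym, real_inner_comm]
      simp only [map_add, map_smul, inner_add_left, inner_add_right, real_inner_smul_left,
        real_inner_smul_right, hs]
      ring
    rw [hsum]
    have h1 : η ^ 2 * β * τ ^ 2 ≤ η ^ 2 * β * δ ^ 2 := by gcongr
    have h2 : η * ψ * (β / 2) ≤ η * ψ * r t := by gcongr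
    have h3 : (η * ψ) ^ 2 * (-M) ≤ (η * ψ) ^ 2 * q t := by gcongr
    have h4 : (η * ψ) ^ 2 * M ≤ (η * δ ^ 2) ^ 2 * M := by gcongr
    have := htr t
    rw [hK]
    nlinarith

/-- Bounds for the trace of a symmetric Riccati solution at the ends of its interval, when the
potential has nonnegative trace. -/
theorem sum_inner_riccati_endpoint_bounds {A S : ℝ → E →L[ℝ] E} (e : OrthonormalBasis ι ℝ E)
    (htr : ∀ t, 0 ≤ ∑ k, ⟪A t (e k), e k⟫) {c d : ℝ} (hcd : c < d)
    (hS : ∀ t ∈ Icc c d, HasDerivWithinAt S (-A t - S t * S t) (Icc c d) t ∧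
      ∀ u w, ⟪S t u, w⟫ = ⟪u, S t w⟫) :
    -(Fintype.card ι / (d - c)) ≤ ∑ k, ⟪S c (e k), e k⟫ ∧
      ∑ k, ⟪S d (e k), e k⟫ ≤ Fintype.card ι / (d - c) := by
  have hL : 0 < d - c := sub_pos.2 hcd
  -- The test fields are linear ramps of slope `±1 / (d - c)`. Choosing `s` as one endpoint removes
  -- the boundary term there and leaves the trace of `S` at the other.
  have aux : ∀ s σ : ℝ, σ ^ 2 = 1 →
      ∑ k, ⟪S d ((σ * (d - s) / (d - c)) • e k), (σ * (d - s) / (d - c)) • e k⟫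
      - ∑ k, ⟪S c ((σ * (c - s) / (d - c)) • e k), (σ * (c - s) / (d - c)) • e k⟫
      ≤ Fintype.card ι / (d - c) := by
    intro s σ hσ
    have hψ : ∀ t : ℝ, HasDerivAt (fun t => σ * (t - s) / (d - c)) (σ / (d - c)) t := fun t => by
      have := (((hasDerivAt_id t).sub_const s).const_mul σ).div_const (d - c)
      simpa using this
    have hG : ∀ t : ℝ, HasDerivAt (fun t => Fintype.card ι / (d - c) ^ 2 * t)
        (Fintype.card ι / (d - c) ^ 2) t := fun t => by
      simpa using (hasDerivAt_id t).const_mul (Fintype.card ι / (d - c) ^ 2 : ℝ)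
    refine (sum_inner_riccati_sub_le hcd.le hS
      (y := fun k t => (σ * (t - s) / (d - c)) • e k) (y' := fun k t => (σ / (d - c)) • e k)
      (fun k t => (hψ t).smul_const (e k)) hG fun t _ => ?_).trans_eq ?_
    · have hsum : ∑ k, (⟪(σ / (d - c)) • e k, (σ / (d - c)) • e k⟫ -
          ⟪A t ((σ * (t - s) / (d - c)) • e k), (σ * (t - s) / (d - c)) • e k⟫) =
          Fintype.card ι / (d - c) ^ 2
            - (σ * (t - s) / (d - c)) ^ 2 * ∑ k, ⟪A t (e k), e k⟫ := by
        rw [Finset.sum_sub_distrib, Finset.mul_sum]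
        congr 1
        · simp [norm_smul, mul_pow, hσ, div_eq_mul_inv]
        · refine Finset.sum_congr rfl fun k _ => ?_
          rw [map_smul, real_inner_smul_left, real_inner_smul_right]
          ring
      rw [hsum]
      have := mul_nonneg (sq_nonneg (σ * (t - s) / (d - c))) (htr t)
      linarith
    · field_simp
  constructor
  · have := aux d (-1) (by norm_num)
    have h1 : (-1 * (c - d) / (d - c) : ℝ) = 1 := by field_simp; ring
    simp only [sub_self, mul_zero, zero_div, zero_smul, map_zero, inner_zero_left, h1, one_smul,
      Finset.sum_const_zero] at this
    linarith
  · have := aux c 1 (by norm_num)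
    have h1 : (1 * (d - c) / (d - c) : ℝ) = 1 := by field_simp
    simp only [sub_self, mul_zero, zero_div, zero_smul, map_zero, inner_zero_left, h1, one_smul,
      Finset.sum_const_zero] at this
    linarith

/-- A linear system `y'' + A y = 0` on the whole line whose symmetric coefficient `A` has
nonnegative trace and does not vanish identically has a pair of conjugate points. -/
theorem exists_conjugate_points [FiniteDimensional ℝ E] {A : ℝ → E →L[ℝ] E} (hA : Continuous A)
    (hsym : ∀ t u w, ⟪A t u, w⟫ = ⟪u, A t w⟫) (e : OrthonormalBasis ι ℝ E)
    (htr : ∀ t, 0 ≤ ∑ k, ⟪A t (e k), e k⟫) {t₀ : ℝ} (h₀ : A t₀ ≠ 0) :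
    ∃ t₁ t₂, t₁ < t₂ ∧ ∃ y p, IsLinearNewtonSolution A (Icc t₁ t₂) y p ∧ y t₁ = 0 ∧ y t₂ = 0 ∧
      p t₁ ≠ 0 := by
  obtain ⟨δ, hδ, m, hm, hdrop⟩ := sum_inner_riccati_drop hA hsym e htr h₀
  set N : ℝ := (Fintype.card ι : ℝ) with hN
  have hN0 : 0 ≤ N := Nat.cast_nonneg _
  -- Then `2 N / L < m`, and `L` is positive even when `N = 0`.
  set L : ℝ := (2 * N + 1) / m with hL
  have hL0 : 0 < L := by positivity
  -- The operator solution vanishes at `a`, where `P D⁻¹` is undefined, so the Riccati interval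
  -- starts one unit of time later.
  rcases exists_conjugate_or_riccati hA hsym (a := t₀ - δ - L - 1) (c := t₀ - δ - L)
    (b := t₀ + δ + L) (by linarith) (by linarith) with ⟨t₂, ht₂, h⟩ | ⟨S, hS⟩
  · exact ⟨_, t₂, ht₂, h⟩
  · exfalso
    have hres : ∀ c d, t₀ - δ - L ≤ c → d ≤ t₀ + δ + L → ∀ t ∈ Icc c d,
        HasDerivWithinAt S (-A t - S t * S t) (Icc c d) t ∧ ∀ u w, ⟪S t u, w⟫ = ⟪u, S t w⟫ :=
      fun c d hc hd t ht => ⟨(hS t (Icc_subset_Icc hc hd ht)).1.mono (Icc_subset_Icc hc hd),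
        (hS t (Icc_subset_Icc hc hd ht)).2⟩
    have h1 := hdrop S (hres _ _ (by linarith) (by linarith))
    have h2 := (sum_inner_riccati_endpoint_bounds e htr (c := t₀ + δ) (d := t₀ + δ + L) (by linarith)
      (hres _ _ (by linarith) (by linarith))).1
    have h3 := (sum_inner_riccati_endpoint_bounds e htr (c := t₀ - δ - L) (d := t₀ - δ) (by linarith)
      (hres _ _ (by linarith) (by linarith))).2
    rw [add_sub_cancel_left] at h2
    rw [sub_sub_cancel] at h3
    have h4 : 2 * (N / L) < m := by
      rw [hL, div_div_eq_mul_div, ← mul_div_assoc, div_lt_iff₀ (by positivity)]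
      nlinarith
    linarith

end Riccati

/-! ### Spatial gradient and Hessian of a time-dependent potential. -/

section SpatialDerivatives

open scoped RealInnerProductSpace

variable {E : Type*} [NormedAddCommGroup E] [InnerProductSpace ℝ E] [CompleteSpace E]

/-- The Riesz representation of functionals on a real Hilbert space, as a linear map. -/
noncomputable def rieszCLM (E : Type*) [NormedAddCommGroup E] [InnerProductSpace ℝ E]
    [CompleteSpace E] : (E →L[ℝ] ℝ) →L[ℝ] E :=
  LinearMap.mkContinuous
    { toFun := fun φ => (InnerProductSpace.toDual ℝ E).symm φ
      map_add' := fun φ ψ => map_add _ φ ψ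
      map_smul' := fun c φ => by simp } 1 (fun φ => by simp)

@[simp]
theorem inner_rieszCLM (φ : E →L[ℝ] ℝ) (u : E) : ⟪rieszCLM E φ, u⟫ = φ u :=
  InnerProductSpace.toDual_symm_apply

/-- The gradient of `W(t, x)` with respect to `x`. -/
noncomputable def spatialGradient (W : ℝ × E → ℝ) (p : ℝ × E) : E :=
  rieszCLM E ((fderiv ℝ W p).comp (ContinuousLinearMap.inr ℝ ℝ E))

/-- The Hessian of `W(t, x)` with respect to `x`, as an endomorphism. -/
noncomputable def spatialHessian (W : ℝ × E → ℝ) (p : ℝ × E) : E →L[ℝ] E :=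
  (rieszCLM E).comp (((ContinuousLinearMap.compL ℝ E (ℝ × E) ℝ).flip
    (ContinuousLinearMap.inr ℝ ℝ E)).comp
    ((fderiv ℝ (fderiv ℝ W) p).comp (ContinuousLinearMap.inr ℝ ℝ E)))

theorem inner_spatialGradient (W : ℝ × E → ℝ) (p : ℝ × E) (u : E) :
    ⟪spatialGradient W p, u⟫ = fderiv ℝ W p (0, u) := by
  simp [spatialGradient]

theorem inner_spatialHessian (W : ℝ × E → ℝ) (p : ℝ × E) (u w : E) :
    ⟪spatialHessian W p u, w⟫ = fderiv ℝ (fderiv ℝ W) p (0, u) (0, w) := by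
  simp [spatialHessian]

theorem inner_spatialHessian_comm {W : ℝ × E → ℝ} {p : ℝ × E} (hW : ContDiffAt ℝ 2 W p)
    (u w : E) : ⟪spatialHessian W p u, w⟫ = ⟪u, spatialHessian W p w⟫ := by
  rw [inner_spatialHessian, real_inner_comm,
    inner_spatialHessian]
  exact (hW.isSymmSndFDerivAt (by simp)) _ _

theorem hasFDerivAt_slice {W : ℝ × E → ℝ} {t : ℝ} {x : E} (hW : DifferentiableAt ℝ W (t, x)) :
    HasFDerivAt (fun z => W (t, z))
      ((fderiv ℝ W (t, x)).comp (ContinuousLinearMap.inr ℝ ℝ E)) x :=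
  hW.hasFDerivAt.comp x (hasFDerivAt_prodMk_right t x)

theorem gradient_slice_eq {W : ℝ × E → ℝ} {t : ℝ} {x : E} (hW : DifferentiableAt ℝ W (t, x)) :
    gradient (fun z => W (t, z)) x = spatialGradient W (t, x) := by
  rw [gradient, (hasFDerivAt_slice hW).fderiv]
  rfl

theorem contDiffAt_fderiv_of_two {F : Type*} [NormedAddCommGroup F] [NormedSpace ℝ F]
    {W : F → ℝ} {p : F} (hW : ContDiffAt ℝ 2 W p) :
    ContDiffAt ℝ 1 (fderiv ℝ W) p :=
  hW.fderiv_right (by norm_num)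

theorem contDiffAt_spatialGradient {W : ℝ × E → ℝ} {p : ℝ × E} (hW : ContDiffAt ℝ 2 W p) :
    ContDiffAt ℝ 1 (spatialGradient W) p :=
  (rieszCLM E).contDiff.contDiffAt.comp p
    ((contDiffAt_fderiv_of_two hW).clm_comp contDiffAt_const)

theorem continuousAt_spatialHessian {W : ℝ × E → ℝ} {p : ℝ × E} (hW : ContDiffAt ℝ 2 W p) :
    ContinuousAt (spatialHessian W) p := by
  have h : ContinuousAt (fderiv ℝ (fderiv ℝ W)) p :=
    ((contDiffAt_fderiv_of_two hW).fderiv_right (m := 0) (by norm_num)).continuousAt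
  exact continuousAt_const.clm_comp (continuousAt_const.clm_comp (h.clm_comp continuousAt_const))

theorem hasFDerivAt_spatialGradient_slice {W : ℝ × E → ℝ} {t : ℝ} {x : E}
    (hW : ContDiffAt ℝ 2 W (t, x)) :
    HasFDerivAt (fun z => spatialGradient W (t, z)) (spatialHessian W (t, x)) x := by
  have h1 : HasFDerivAt (fderiv ℝ W) (fderiv ℝ (fderiv ℝ W) (t, x)) (t, x) :=
    ((contDiffAt_fderiv_of_two hW).differentiableAt one_ne_zero).hasFDerivAt
  exact ((rieszCLM E).comp ((ContinuousLinearMap.compL ℝ E (ℝ × E) ℝ).flip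
    (ContinuousLinearMap.inr ℝ ℝ E))).hasFDerivAt.comp x
      (h1.comp x (hasFDerivAt_prodMk_right t x))

/-- Translates the hypotheses on `V_{ij}` and `Δ_x V`, which concern slices of `V`, into statements
about the coefficient `A`. -/
theorem iteratedFDeriv_two_slice {W : ℝ × E → ℝ} {t : ℝ} {x : E}
    (hW : ContDiffAt ℝ 2 W (t, x)) (u w : E) :
    iteratedFDeriv ℝ 2 (fun z => W (t, z)) x ![u, w] = ⟪spatialHessian W (t, x) u, w⟫ := by
  have hev : ∀ᶠ z in 𝓝 x, fderiv ℝ (fun z => W (t, z)) z =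
      (fderiv ℝ W (t, z)).comp (ContinuousLinearMap.inr ℝ ℝ E) := by
    have : ∀ᶠ p in 𝓝 (t, x), ContDiffAt ℝ 2 W p := hW.eventually (by simp)
    have hc : ContinuousAt (fun z : E => (t, z)) x := by fun_prop
    filter_upwards [hc.eventually this] with z hz
    exact (hasFDerivAt_slice (hz.differentiableAt two_ne_zero)).fderiv
  have h1 : HasFDerivAt (fderiv ℝ W) (fderiv ℝ (fderiv ℝ W) (t, x)) (t, x) :=
    ((contDiffAt_fderiv_of_two hW).differentiableAt one_ne_zero).hasFDerivAt
  have h2 := ((ContinuousLinearMap.compL ℝ E (ℝ × E) ℝ).flip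
    (ContinuousLinearMap.inr ℝ ℝ E)).hasFDerivAt.comp x
      (h1.comp x (hasFDerivAt_prodMk_right t x))
  rw [iteratedFDeriv_two_apply, Filter.EventuallyEq.fderiv_eq hev]
  erw [h2.fderiv]
  rw [inner_spatialHessian]
  rfl

end SpatialDerivatives

/-! ### Christoffel symbols and curvature of the pp-wave. -/

section PPGeometry

open scoped RealInnerProductSpace

variable {n : ℕ} (V : ℝ → EuclideanSpace ℝ (Fin n) → ℝ)

/-- The coordinates `(t, x)` of a point. -/
noncomputable def timeSpaceCLM (n : ℕ) : (Fin 2 ⊕ Fin n → ℝ) →L[ℝ] ℝ × EuclideanSpace ℝ (Fin n) :=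
  (ContinuousLinearMap.proj (Sum.inl 1)).prod
    ((PiLp.continuousLinearEquiv 2 ℝ (fun _ : Fin n => ℝ)).symm.toContinuousLinearMap.comp
      (ContinuousLinearMap.pi fun i => ContinuousLinearMap.proj (Sum.inr i)))

theorem timeSpaceCLM_apply (p : Fin 2 ⊕ Fin n → ℝ) :
    timeSpaceCLM n p = (p (Sum.inl 1), spatialPart p) := rfl

@[simp]
theorem timeSpaceCLM_brinkmannPoint (v t : ℝ) (x : EuclideanSpace ℝ (Fin n)) :
    timeSpaceCLM n (brinkmannPoint v t x) = (t, x) := rfl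

@[simp]
theorem timeSpaceCLM_single_inl_zero :
    timeSpaceCLM n (Pi.single (Sum.inl 0) 1) = 0 := by
  rw [timeSpaceCLM_apply]
  ext i <;> simp [spatialPart]

@[simp]
theorem timeSpaceCLM_single_inl_one :
    timeSpaceCLM n (Pi.single (Sum.inl 1) 1) = (1, 0) := by
  rw [timeSpaceCLM_apply]
  ext i <;> simp [spatialPart]

@[simp]
theorem timeSpaceCLM_single_inr (i : Fin n) :
    timeSpaceCLM n (Pi.single (Sum.inr i) 1) = (0, EuclideanSpace.single i 1) := by
  rw [timeSpaceCLM_apply]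
  ext j
  · simp
  · simp [spatialPart, Pi.single_apply]

/-- The potential as a function of Brinkmann coordinates. -/
noncomputable def liftedPotential (q : Fin 2 ⊕ Fin n → ℝ) : ℝ :=
  V (q (Sum.inl 1)) (spatialPart q)

theorem liftedPotential_eq :
    liftedPotential V = (fun p : ℝ × EuclideanSpace ℝ (Fin n) => V p.1 p.2) ∘ timeSpaceCLM n := rfl

theorem ppMetric_inv (p : Fin 2 ⊕ Fin n → ℝ) :
    (ppMetric V p)⁻¹ = Matrix.fromBlocks !![2 * liftedPotential V p, 1; 1, 0] 0 0 1 := by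
  refine Matrix.inv_eq_right_inv ?_
  rw [ppMetric, Matrix.fromBlocks_multiply, ← Matrix.fromBlocks_one]
  congr 1
  · ext i j
    fin_cases i <;> fin_cases j <;> simp [liftedPotential]
  all_goals simp

/-- The component `dt(∂_b)`. -/
def timeIndicator : Fin 2 ⊕ Fin n → ℝ := Sum.elim ![0, 1] 0

@[simp]
theorem timeIndicator_inl_zero : timeIndicator (n := n) (Sum.inl 0) = 0 := rfl

@[simp]
theorem timeIndicator_inl_one : timeIndicator (n := n) (Sum.inl 1) = 1 := rfl

@[simp]
theorem timeIndicator_inr (i : Fin n) : timeIndicator (Sum.inr i) = 0 := rfl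

theorem coordDeriv_ppMetric (a b c : Fin 2 ⊕ Fin n) (p : Fin 2 ⊕ Fin n → ℝ) :
    coordDeriv a (fun q => ppMetric V q b c) p =
      -2 * timeIndicator b * timeIndicator c * coordDeriv a (liftedPotential V) p := by
  have h : coordDeriv a (fun q => -2 * V (q (Sum.inl 1)) (spatialPart q)) p =
      -2 * coordDeriv a (liftedPotential V) p := by
    have := fderiv_const_smul_field (𝕜 := ℝ) (f := liftedPotential V) (-2 : ℝ)
    exact DFunLike.congr_fun (congrFun this p) (Pi.single a 1)
  rcases b with b | b <;> rcases c with c | c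
  · fin_cases b <;> fin_cases c <;>
      simp only [ppMetric, timeIndicator, Matrix.fromBlocks_apply₁₁] <;> simp [coordDeriv]
    simpa [coordDeriv] using h
  all_goals simp [ppMetric, timeIndicator, coordDeriv]

/-- The potential does not involve `v`. Where it is not differentiable, the derivative takes its
default value zero, so the Christoffel formulas need no regularity of `V`. -/
theorem coordDeriv_inl_zero_liftedPotential :
    coordDeriv (Sum.inl 0) (liftedPotential V) = 0 := by
  funext p
  by_cases hd : DifferentiableAt ℝ (liftedPotential V) p
  · have h1 := hd.lineDeriv_eq_fderiv (v := Pi.single (Sum.inl 0) 1)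
    rw [coordDeriv, ← h1, lineDeriv]
    have : (fun s : ℝ => liftedPotential V (p + s • Pi.single (Sum.inl 0) 1)) =
        fun _ => liftedPotential V p := by
      funext s
      simp [liftedPotential_eq]
    rw [this]
    simp
  · rw [coordDeriv, fderiv_zero_of_not_differentiableAt hd]
    simp

theorem christoffel_ppMetric_inl_zero (b c : Fin 2 ⊕ Fin n) (p : Fin 2 ⊕ Fin n → ℝ) :
    christoffel (ppMetric V) (Sum.inl 0) b c p =
      timeIndicator b * timeIndicator c * coordDeriv (Sum.inl 1) (liftedPotential V) p
      - timeIndicator c * coordDeriv b (liftedPotential V) p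
      - timeIndicator b * coordDeriv c (liftedPotential V) p := by
  simp only [christoffel, ppMetric_inv, coordDeriv_ppMetric, Fintype.sum_sum_type,
    Fin.sum_univ_two, Matrix.fromBlocks_apply₁₁, Matrix.fromBlocks_apply₁₂]
  simp [timeIndicator, coordDeriv_inl_zero_liftedPotential]
  ring

theorem christoffel_ppMetric_inl_one (b c : Fin 2 ⊕ Fin n) (p : Fin 2 ⊕ Fin n → ℝ) :
    christoffel (ppMetric V) (Sum.inl 1) b c p = 0 := by
  simp only [christoffel, ppMetric_inv, coordDeriv_ppMetric, Fintype.sum_sum_type,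
    Fin.sum_univ_two, Matrix.fromBlocks_apply₁₁, Matrix.fromBlocks_apply₁₂]
  simp [timeIndicator, coordDeriv_inl_zero_liftedPotential]

theorem christoffel_ppMetric_inr (i : Fin n) (b c : Fin 2 ⊕ Fin n) (p : Fin 2 ⊕ Fin n → ℝ) :
    christoffel (ppMetric V) (Sum.inr i) b c p =
      timeIndicator b * timeIndicator c * coordDeriv (Sum.inr i) (liftedPotential V) p := by
  simp only [christoffel, ppMetric_inv, coordDeriv_ppMetric, Fintype.sum_sum_type,
    Fin.sum_univ_two, Matrix.fromBlocks_apply₂₁, Matrix.fromBlocks_apply₂₂, Matrix.one_apply]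
  simp [timeIndicator]
  ring

variable {V}

theorem contDiffAt_liftedPotential {p : Fin 2 ⊕ Fin n → ℝ}
    (hV : ContDiffAt ℝ 2 (fun p : ℝ × EuclideanSpace ℝ (Fin n) => V p.1 p.2) (timeSpaceCLM n p)) :
    ContDiffAt ℝ 2 (liftedPotential V) p := by
  rw [liftedPotential_eq]
  exact hV.comp p (timeSpaceCLM n).contDiff.contDiffAt

theorem coordDeriv_liftedPotential {p : Fin 2 ⊕ Fin n → ℝ}
    (hV : DifferentiableAt ℝ (fun p : ℝ × EuclideanSpace ℝ (Fin n) => V p.1 p.2)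
      (timeSpaceCLM n p)) (a : Fin 2 ⊕ Fin n) :
    coordDeriv a (liftedPotential V) p =
      fderiv ℝ (fun p : ℝ × EuclideanSpace ℝ (Fin n) => V p.1 p.2) (timeSpaceCLM n p)
        (timeSpaceCLM n (Pi.single a 1)) := by
  rw [coordDeriv, liftedPotential_eq, (hV.hasFDerivAt.comp p (timeSpaceCLM n).hasFDerivAt).fderiv]
  rfl

theorem hasFDerivAt_coordDeriv_liftedPotential {p : Fin 2 ⊕ Fin n → ℝ}
    (hV : ContDiffAt ℝ 2 (fun p : ℝ × EuclideanSpace ℝ (Fin n) => V p.1 p.2) (timeSpaceCLM n p))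
    (a : Fin 2 ⊕ Fin n) :
    HasFDerivAt (coordDeriv a (liftedPotential V))
      ((fderiv ℝ (fderiv ℝ (liftedPotential V)) p).flip (Pi.single a 1)) p := by
  have h1 : HasFDerivAt (fderiv ℝ (liftedPotential V))
      (fderiv ℝ (fderiv ℝ (liftedPotential V)) p) p :=
    ((contDiffAt_fderiv_of_two (contDiffAt_liftedPotential hV)).differentiableAt
      one_ne_zero).hasFDerivAt
  have := h1.clm_apply (hasFDerivAt_const (Pi.single a (1 : ℝ)) p)
  simp only [ContinuousLinearMap.comp_zero, zero_add] at this
  exact this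

theorem fderiv_fderiv_liftedPotential {p : Fin 2 ⊕ Fin n → ℝ}
    (hV : ContDiffAt ℝ 2 (fun p : ℝ × EuclideanSpace ℝ (Fin n) => V p.1 p.2) (timeSpaceCLM n p))
    (u w : Fin 2 ⊕ Fin n → ℝ) :
    fderiv ℝ (fderiv ℝ (liftedPotential V)) p u w =
      fderiv ℝ (fderiv ℝ (fun p : ℝ × EuclideanSpace ℝ (Fin n) => V p.1 p.2)) (timeSpaceCLM n p)
        (timeSpaceCLM n u) (timeSpaceCLM n w) := by
  set W := fun p : ℝ × EuclideanSpace ℝ (Fin n) => V p.1 p.2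
  have hev : fderiv ℝ (liftedPotential V) =ᶠ[𝓝 p]
      fun q => (fderiv ℝ W (timeSpaceCLM n q)).comp (timeSpaceCLM n) := by
    have := hV.eventually (by simp)
    filter_upwards [(timeSpaceCLM n).continuous.continuousAt.eventually this] with q hq
    rw [liftedPotential_eq]
    exact ((hq.differentiableAt two_ne_zero).hasFDerivAt.comp q
      (timeSpaceCLM n).hasFDerivAt).fderiv
  have h1 : HasFDerivAt (fderiv ℝ W) (fderiv ℝ (fderiv ℝ W) (timeSpaceCLM n p))
      (timeSpaceCLM n p) :=
    ((contDiffAt_fderiv_of_two hV).differentiableAt one_ne_zero).hasFDerivAt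
  have h2 := (h1.comp p (timeSpaceCLM n).hasFDerivAt).clm_comp
    (hasFDerivAt_const (timeSpaceCLM n) p)
  rw [hev.fderiv_eq]
  erw [h2.fderiv]
  simp

@[simp]
theorem spatialHessian_single_apply (W : ℝ × EuclideanSpace ℝ (Fin n) → ℝ)
    (p : ℝ × EuclideanSpace ℝ (Fin n)) (i j : Fin n) :
    fderiv ℝ (fderiv ℝ W) p (0, EuclideanSpace.single j 1) (0, EuclideanSpace.single i 1) =
      spatialHessian W p (EuclideanSpace.single j 1) i := by
  rw [← inner_spatialHessian]
  simp [EuclideanSpace.inner_single_right]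

theorem sum_apply_single_mul (A : EuclideanSpace ℝ (Fin n) →L[ℝ] EuclideanSpace ℝ (Fin n))
    (y : EuclideanSpace ℝ (Fin n)) (i : Fin n) :
    ∑ j, A (EuclideanSpace.single j 1) i * y j = A y i := by
  have hy : y = ∑ j, y j • EuclideanSpace.single j (1 : ℝ) := by
    ext k
    simp [Finset.sum_apply, Pi.single_apply]
  conv_rhs => rw [hy]
  simp [mul_comm]

section AtPoint

variable {v t : ℝ} {x : EuclideanSpace ℝ (Fin n)}

/-- The curvature of the pp-wave along `∂_t`-normalized directions is the Hessian of the
potential. -/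
theorem curvatureEndo_ppMetric
    (hV : ContDiffAt ℝ 2 (fun p : ℝ × EuclideanSpace ℝ (Fin n) => V p.1 p.2) (t, x))
    (jv v' : ℝ) (y x' : EuclideanSpace ℝ (Fin n)) :
    curvatureEndo (ppMetric V) (brinkmannPoint v t x) (brinkmannPoint jv 0 y)
      (brinkmannPoint v' 1 x') (brinkmannPoint v' 1 x') =
      brinkmannPoint
        (-⟪spatialHessian (fun p => V p.1 p.2) (t, x) y, x'⟫) 0
        (spatialHessian (fun p => V p.1 p.2) (t, x) y) := by
  set W := fun p : ℝ × EuclideanSpace ℝ (Fin n) => V p.1 p.2 with hW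
  set p := brinkmannPoint v t x with hp
  have hVp : ContDiffAt ℝ 2 W (timeSpaceCLM n p) := hV
  set A := spatialHessian W (t, x) with hA
  set Q := fderiv ℝ (fderiv ℝ (liftedPotential V)) p with hQ
  have hd : ∀ a, HasFDerivAt (coordDeriv a (liftedPotential V)) (Q.flip (Pi.single a 1)) p :=
    hasFDerivAt_coordDeriv_liftedPotential hVp
  have hsymm : ∀ u w, Q u w = Q w u := fun u w =>
    ((contDiffAt_liftedPotential hVp).isSymmSndFDerivAt (by simp)) u w
  have hQ0 : ∀ w, Q (Pi.single (Sum.inl 0) 1) w = 0 := fun w => by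
    rw [hQ, fderiv_fderiv_liftedPotential hVp]
    simp
  have hQ0' : ∀ w, Q w (Pi.single (Sum.inl 0) 1) = 0 := fun w => by rw [hsymm, hQ0]
  have hQij : ∀ i j : Fin n, Q (Pi.single (Sum.inr j) 1) (Pi.single (Sum.inr i) 1) =
      A (EuclideanSpace.single j 1) i := fun i j => by
    rw [hQ, fderiv_fderiv_liftedPotential hVp]
    simp [hA, hp, hW]
  have c1 : ∀ b c d, curvatureCoeff (ppMetric V) (Sum.inl 1) b c d p = 0 := fun b c d => by
    have : ∀ b c, christoffel (ppMetric V) (Sum.inl 1) b c = fun _ => 0 := fun b c =>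
      funext (christoffel_ppMetric_inl_one V b c)
    simp [curvatureCoeff, this, coordDeriv]
  -- All `Γ^t` vanish and no symbol has a lower index `v`, so only `e` spatial and `a = v` can
  -- contribute. There the product is symmetric in `c` and `d`, and the difference cancels.
  have quad : ∀ a b c d, ∑ e, (christoffel (ppMetric V) a c e p * christoffel (ppMetric V) e d b p
      - christoffel (ppMetric V) a d e p * christoffel (ppMetric V) e c b p) = 0 := fun a b c d => by
    rcases a with a | a
    · fin_cases a
      · simp [Fintype.sum_sum_type, Fin.sum_univ_two, christoffel_ppMetric_inl_zero,
          christoffel_ppMetric_inl_one, christoffel_ppMetric_inr,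
          coordDeriv_inl_zero_liftedPotential]
        rw [← Finset.sum_neg_distrib, ← Finset.sum_add_distrib]
        exact Finset.sum_eq_zero fun i _ => by ring
      · simp [christoffel_ppMetric_inl_one]
    · simp [Fintype.sum_sum_type, Fin.sum_univ_two, christoffel_ppMetric_inl_one,
        christoffel_ppMetric_inr]
  have ci : ∀ i b c d, curvatureCoeff (ppMetric V) (Sum.inr i) b c d p =
      timeIndicator d * timeIndicator b * Q (Pi.single c 1) (Pi.single (Sum.inr i) 1)
      - timeIndicator c * timeIndicator b * Q (Pi.single d 1) (Pi.single (Sum.inr i) 1) :=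
    fun i b c d => by
      have : ∀ b c d, coordDeriv c (christoffel (ppMetric V) (Sum.inr i) d b) p =
          timeIndicator d * timeIndicator b * Q (Pi.single c 1) (Pi.single (Sum.inr i) 1) :=
        fun b c d => by
          rw [funext (christoffel_ppMetric_inr V i d b), coordDeriv,
            ((hd (Sum.inr i)).const_mul (timeIndicator d * timeIndicator b)).fderiv]
          simp
      rw [curvatureCoeff, quad, this, this, add_zero]
  have cv : ∀ b c d, curvatureCoeff (ppMetric V) (Sum.inl 0) b c d p =
      timeIndicator c * Q (Pi.single d 1) (Pi.single b 1)
      - timeIndicator d * Q (Pi.single c 1) (Pi.single b 1)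
      + timeIndicator d * timeIndicator b * Q (Pi.single c 1) (Pi.single (Sum.inl 1) 1)
      - timeIndicator c * timeIndicator b * Q (Pi.single d 1) (Pi.single (Sum.inl 1) 1) :=
    fun b c d => by
      have : ∀ b c d, coordDeriv c (christoffel (ppMetric V) (Sum.inl 0) d b) p =
          timeIndicator d * timeIndicator b * Q (Pi.single c 1) (Pi.single (Sum.inl 1) 1)
          - timeIndicator b * Q (Pi.single c 1) (Pi.single d 1)
          - timeIndicator d * Q (Pi.single c 1) (Pi.single b 1) :=
        fun b c d => by
          rw [funext (christoffel_ppMetric_inl_zero V d b), coordDeriv,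
            ((((hd (Sum.inl 1)).const_mul (timeIndicator d * timeIndicator b)).fun_sub
              ((hd d).const_mul (timeIndicator b))).fun_sub
                ((hd b).const_mul (timeIndicator d))).fderiv]
          simp
      rw [curvatureCoeff, quad, this, this, hsymm (Pi.single d 1) (Pi.single c 1)]
      ring
  have hAi : ∀ i, ∑ j, Q (Pi.single (Sum.inr j) 1) (Pi.single (Sum.inr i) 1) * y j = A y i :=
    fun i => by simp only [hQij, sum_apply_single_mul]
  funext a
  rcases a with a | i
  · fin_cases a
    · simp only [curvatureEndo, cv, Fintype.sum_sum_type, Fin.sum_univ_two, Fin.zero_eta]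
      simp [timeIndicator, brinkmannPoint, hQ0, hQ0', PiLp.inner_apply]
      refine Finset.sum_congr rfl fun i _ => ?_
      rw [← hAi, Finset.mul_sum]
      exact Finset.sum_congr rfl fun j _ => by ring
    · simp [curvatureEndo, c1, brinkmannPoint]
  · simp only [curvatureEndo, ci, Fintype.sum_sum_type, Fin.sum_univ_two]
    simp [timeIndicator, brinkmannPoint, hQ0, hAi]

/-- Used with `τ = 1` for the geodesic equation and with `τ = 0` for Jacobi fields. -/
theorem covDerivAlong_ppMetric
    (hV : DifferentiableAt ℝ (fun p : ℝ × EuclideanSpace ℝ (Fin n) => V p.1 p.2) (t, x))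
    {I : Set ℝ} {γ X : ℝ → Fin 2 ⊕ Fin n → ℝ} {v' ξ τ ξ' τ' : ℝ}
    {x' w w' : EuclideanSpace ℝ (Fin n)} (hγ : γ t = brinkmannPoint v t x)
    (hγ' : derivWithin γ I t = brinkmannPoint v' 1 x') (hX : X t = brinkmannPoint ξ τ w)
    (hX' : derivWithin X I t = brinkmannPoint ξ' τ' w') :
    covDerivAlong (ppMetric V) I γ X t =
      brinkmannPoint (ξ' - ⟪spatialGradient (fun p => V p.1 p.2) (t, x), w⟫
        - τ * (⟪spatialGradient (fun p => V p.1 p.2) (t, x), x'⟫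
          + fderiv ℝ (fun p : ℝ × EuclideanSpace ℝ (Fin n) => V p.1 p.2) (t, x) (1, 0))) τ'
        (w' + τ • spatialGradient (fun p => V p.1 p.2) (t, x)) := by
  set W := fun p : ℝ × EuclideanSpace ℝ (Fin n) => V p.1 p.2 with hW
  have hVp : DifferentiableAt ℝ W (timeSpaceCLM n (γ t)) := by rw [hγ]; exact hV
  have hH : ∀ i, coordDeriv (Sum.inr i) (liftedPotential V) (γ t) = spatialGradient W (t, x) i :=
    fun i => by
      rw [coordDeriv_liftedPotential hVp, hγ, timeSpaceCLM_single_inr,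
        timeSpaceCLM_brinkmannPoint, ← inner_spatialGradient]
      simp [EuclideanSpace.inner_single_right, hW]
  have hHt : coordDeriv (Sum.inl 1) (liftedPotential V) (γ t) = fderiv ℝ W (t, x) (1, 0) := by
    rw [coordDeriv_liftedPotential hVp, hγ]
    simp [hW]
  funext a
  simp only [covDerivAlong, hγ', hX, hX']
  rcases a with a | i
  · fin_cases a
    · simp only [christoffel_ppMetric_inl_zero, Fintype.sum_sum_type, Fin.sum_univ_two, hH,
        hHt, Fin.zero_eta, coordDeriv_inl_zero_liftedPotential]
      simp [timeIndicator, brinkmannPoint, PiLp.inner_apply]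
      simp only [← Finset.sum_mul, mul_comm (w _), mul_comm (x' _)]
      ring
    · simp [christoffel_ppMetric_inl_one, brinkmannPoint]
  · simp only [christoffel_ppMetric_inr, Fintype.sum_sum_type, Fin.sum_univ_two, hH]
    simp [timeIndicator, brinkmannPoint]
    ring

end AtPoint

end PPGeometry

/-! ### Lifts of Newton solutions to geodesics and Jacobi fields. -/

section GeodesicLift

open scoped RealInnerProductSpace

theorem contDiffOn_succ_of_hasDerivWithinAt {F : Type*} [NormedAddCommGroup F] [NormedSpace ℝ F]
    {I : Set ℝ} (hI : UniqueDiffOn ℝ I) {m : ℕ} {f g : ℝ → F}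
    (hf : ∀ t ∈ I, HasDerivWithinAt f (g t) I t) (hg : ContDiffOn ℝ m g I) :
    ContDiffOn ℝ (m + 1) f I := by
  rw [contDiffOn_succ_iff_derivWithin hI]
  refine ⟨fun t ht => (hf t ht).differentiableWithinAt, by simp, ?_⟩
  exact hg.congr fun t ht => (hf t ht).derivWithin (hI t ht)

variable {n : ℕ} {V : ℝ → EuclideanSpace ℝ (Fin n) → ℝ} {U : Set (EuclideanSpace ℝ (Fin n))}
  {I : Set ℝ}

theorem HasDerivWithinAt.brinkmannPoint {v τ : ℝ → ℝ} {x : ℝ → EuclideanSpace ℝ (Fin n)}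
    {v' τ' t : ℝ} {x' : EuclideanSpace ℝ (Fin n)} (hv : HasDerivWithinAt v v' I t)
    (hτ : HasDerivWithinAt τ τ' I t) (hx : HasDerivWithinAt x x' I t) :
    HasDerivWithinAt (fun s => brinkmannPoint (v s) (τ s) (x s)) (brinkmannPoint v' τ' x') I t := by
  rw [hasDerivWithinAt_pi]
  rintro (a | i)
  · fin_cases a
    · exact hv
    · exact hτ
  · exact (EuclideanSpace.proj (𝕜 := ℝ) i).hasFDerivAt.comp_hasDerivWithinAt t hx

theorem brinkmannPoint_add (v w t s : ℝ) (x y : EuclideanSpace ℝ (Fin n)) :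
    brinkmannPoint v t x + brinkmannPoint w s y = brinkmannPoint (v + w) (t + s) (x + y) := by
  funext a
  rcases a with a | i
  · fin_cases a <;> rfl
  · rfl

@[simp]
theorem brinkmannPoint_zero : brinkmannPoint 0 0 (0 : EuclideanSpace ℝ (Fin n)) = 0 := by
  funext a
  rcases a with a | i
  · fin_cases a <;> rfl
  · rfl

/-- A solution of the Newton equation, in first order form. -/
structure IsNewtonPair (V : ℝ → EuclideanSpace ℝ (Fin n) → ℝ)
    (U : Set (EuclideanSpace ℝ (Fin n))) (I : Set ℝ)
    (x x' : ℝ → EuclideanSpace ℝ (Fin n)) : Prop where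
  mapsTo : MapsTo x I U
  deriv_fst : ∀ t ∈ I, HasDerivWithinAt x (x' t) I t
  deriv_snd : ∀ t ∈ I,
    HasDerivWithinAt x' (-spatialGradient (fun p => V p.1 p.2) (t, x t)) I t

variable {x x' : ℝ → EuclideanSpace ℝ (Fin n)}

theorem IsNewtonPair.isNewtonSolutionOn (hI : UniqueDiffOn ℝ I)
    (hV : ∀ p : ℝ × EuclideanSpace ℝ (Fin n), p.2 ∈ U → ContDiffAt ℝ 2 (fun p => V p.1 p.2) p)
    (h : IsNewtonPair V U I x x') : IsNewtonSolutionOn V U I x where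
  mapsTo := h.mapsTo
  differentiableOn t ht := (h.deriv_fst t ht).differentiableWithinAt
  hasDerivWithinAt t ht := by
    have heq : ∀ s ∈ I, derivWithin x I s = x' s := fun s hs =>
      (h.deriv_fst s hs).derivWithin (hI s hs)
    have hg := gradient_slice_eq ((hV (t, x t) (h.mapsTo ht)).differentiableAt two_ne_zero)
    have := (h.deriv_snd t ht).congr heq (heq t ht)
    rwa [← hg] at this

theorem IsNewtonSolutionOn.isNewtonPair
    (hV : ∀ p : ℝ × EuclideanSpace ℝ (Fin n), p.2 ∈ U → ContDiffAt ℝ 2 (fun p => V p.1 p.2) p)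
    (h : IsNewtonSolutionOn V U I x) : IsNewtonPair V U I x (derivWithin x I) where
  mapsTo := h.mapsTo
  deriv_fst t ht := (h.differentiableOn t ht).hasDerivWithinAt
  deriv_snd t ht := by
    rw [← gradient_slice_eq ((hV (t, x t) (h.mapsTo ht)).differentiableAt two_ne_zero)]
    exact h.hasDerivWithinAt t ht

theorem IsNewtonPair.mono {I' : Set ℝ} (h : IsNewtonPair V U I x x') (hI : I' ⊆ I) :
    IsNewtonPair V U I' x x' :=
  ⟨h.mapsTo.mono_left hI, fun t ht => (h.deriv_fst t (hI ht)).mono hI,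
    fun t ht => (h.deriv_snd t (hI ht)).mono hI⟩

/-- The velocity of the `v` coordinate of a lightlike lift: the negative of the Lagrangian. -/
noncomputable def liftVelocity (W : ℝ × EuclideanSpace ℝ (Fin n) → ℝ) (t : ℝ)
    (x x' : EuclideanSpace ℝ (Fin n)) : ℝ :=
  W (t, x) - (1 / 2) * ⟪x', x'⟫

theorem IsNewtonPair.hasDerivWithinAt_lift (h : IsNewtonPair V U I x x')
    {v : ℝ → ℝ}
    (hv : ∀ t ∈ I, HasDerivWithinAt v (liftVelocity (fun p => V p.1 p.2) t (x t) (x' t)) I t)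
    {t : ℝ} (ht : t ∈ I) :
    HasDerivWithinAt (fun s => brinkmannPoint (v s) s (x s))
      (brinkmannPoint (liftVelocity (fun p => V p.1 p.2) t (x t) (x' t)) 1 (x' t)) I t :=
  (hv t ht).brinkmannPoint (hasDerivWithinAt_id t I) (h.deriv_fst t ht)

/-- The spatial geodesic equation is Newton's and the one for `t` is trivial. The one for `v` is
`v'' = 2 ⟪∇V, x'⟫ + ∂_t V`, which is the derivative of `V - |x'|² / 2` along a solution. -/
theorem IsNewtonPair.isGeodesicLiftOn (hI : UniqueDiffOn ℝ I)
    (hV : ∀ p : ℝ × EuclideanSpace ℝ (Fin n), p.2 ∈ U → ContDiffAt ℝ 2 (fun p => V p.1 p.2) p)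
    (h : IsNewtonPair V U I x x') {v : ℝ → ℝ}
    (hv : ∀ t ∈ I, HasDerivWithinAt v (liftVelocity (fun p => V p.1 p.2) t (x t) (x' t)) I t) :
    IsGeodesicLiftOn V U I x (fun s => brinkmannPoint (v s) s (x s)) := by
  set W := fun p : ℝ × EuclideanSpace ℝ (Fin n) => V p.1 p.2 with hW
  have hder : ∀ t ∈ I, derivWithin (fun s => brinkmannPoint (v s) s (x s)) I t =
      brinkmannPoint (liftVelocity W t (x t) (x' t)) 1 (x' t) := fun t ht =>
    (h.hasDerivWithinAt_lift hv ht).derivWithin (hI t ht)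
  have hsec : ∀ t ∈ I, HasDerivWithinAt
      (derivWithin (fun s => brinkmannPoint (v s) s (x s)) I)
      (brinkmannPoint (2 * ⟪spatialGradient W (t, x t), x' t⟫ + fderiv ℝ W (t, x t) (1, 0)) 0
        (-spatialGradient W (t, x t))) I t := fun t ht => by
    have hWd := ((hV (t, x t) (h.mapsTo ht)).differentiableAt two_ne_zero).hasFDerivAt
    have h1 : HasDerivWithinAt (fun s => W (s, x s)) (fderiv ℝ W (t, x t) (1, x' t)) I t :=
      hWd.comp_hasDerivWithinAt (f := fun s => (s, x s)) t ((hasDerivWithinAt_id t I).prodMk (h.deriv_fst t ht))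
    have h2 := (h.deriv_snd t ht).inner ℝ (h.deriv_snd t ht)
    have h3 : HasDerivWithinAt (fun s => liftVelocity W s (x s) (x' s))
        (2 * ⟪spatialGradient W (t, x t), x' t⟫ + fderiv ℝ W (t, x t) (1, 0)) I t := by
      refine (h1.sub (h2.const_mul (1 / 2))).congr_deriv ?_
      have e : ((1 : ℝ), x' t) = (1, 0) + (0, x' t) := by simp
      rw [e, map_add, ← inner_spatialGradient, inner_neg_left, inner_neg_right, real_inner_comm]
      ring
    exact (h3.brinkmannPoint (hasDerivWithinAt_const t I 1) (h.deriv_snd t ht)).congr hder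
      (hder t ht)
  refine ⟨⟨fun t ht => h.mapsTo ht, fun t ht => (h.hasDerivWithinAt_lift hv ht).differentiableWithinAt,
    fun t ht => (hsec t ht).differentiableWithinAt, fun t ht => ?_⟩, v, fun t _ => rfl⟩
  rw [covDerivAlong_ppMetric ((hV (t, x t) (h.mapsTo ht)).differentiableAt two_ne_zero) rfl
    (hder t ht) (hder t ht) ((hsec t ht).derivWithin (hI t ht))]
  rw [← brinkmannPoint_zero]
  congr 1
  · ring
  · simp [hW]

/-- Here `g(γ', γ') = 2 v' - 2 V + |x'|²`, which `liftVelocity` makes zero; `γ'` is nonzero because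
its `t` component is one. -/
theorem IsNewtonPair.isLightlikeOn (hI : UniqueDiffOn ℝ I) (h : IsNewtonPair V U I x x') {v : ℝ → ℝ}
    (hv : ∀ t ∈ I, HasDerivWithinAt v (liftVelocity (fun p => V p.1 p.2) t (x t) (x' t)) I t) :
    IsLightlikeOn (ppMetric V) I (fun s => brinkmannPoint (v s) s (x s)) := by
  intro t ht
  rw [(h.hasDerivWithinAt_lift hv ht).derivWithin (hI t ht)]
  constructor
  · intro h0
    have := congrFun h0 (Sum.inl 1)
    simp [brinkmannPoint] at this
  · have hp : spatialPart (Sum.elim ![v t, t] fun i => x t i) = x t := rfl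
    have hn : ‖x' t‖ ^ 2 = ∑ i, x' t i * x' t i := by
      rw [EuclideanSpace.real_norm_sq_eq]
      exact Finset.sum_congr rfl fun i _ => sq _
    have hone : ∀ i, ∑ j, (1 : Matrix (Fin n) (Fin n) ℝ) i j * x' t j = x' t i := fun i => by
      simp [Matrix.one_apply]
    simp [ppMetric, brinkmannPoint, dotProduct, Fintype.sum_sum_type, Fin.sum_univ_two,
      Matrix.mulVec, liftVelocity, hp, hone, hn]
    ring

/-- A Jacobi field has `v` component `-⟪x', y⟫` and must be `C²`. Bootstrapping gives this: `x` is
`C¹`, hence so is the gradient along `x`, which is `-x''`. -/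
theorem IsNewtonPair.contDiffOn_deriv (hI : UniqueDiffOn ℝ I)
    (hV : ∀ p : ℝ × EuclideanSpace ℝ (Fin n), p.2 ∈ U → ContDiffAt ℝ 2 (fun p => V p.1 p.2) p)
    (h : IsNewtonPair V U I x x') : ContDiffOn ℝ 2 x' I := by
  have hx1 : ContDiffOn ℝ 1 x I := by
    have := contDiffOn_succ_of_hasDerivWithinAt hI (m := 0) h.deriv_fst
      (contDiffOn_zero.2 fun t ht => (h.deriv_snd t ht).continuousWithinAt)
    exact_mod_cast this
  have hg1 : ContDiffOn ℝ 1 (fun t => -spatialGradient (fun p => V p.1 p.2) (t, x t)) I :=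
    fun t ht => (ContDiffAt.comp_contDiffWithinAt (f := fun s => (s, x s)) t
      (contDiffAt_spatialGradient (hV (t, x t) (h.mapsTo ht)))
      (contDiffWithinAt_id.prodMk (hx1 t ht))).neg
  have := contDiffOn_succ_of_hasDerivWithinAt hI (m := 1) h.deriv_snd hg1
  rwa [show ((1 : ℕ) : WithTop ℕ∞) + 1 = 2 by norm_num] at this

theorem IsNewtonPair.continuousOn_spatialHessian
    (hV : ∀ p : ℝ × EuclideanSpace ℝ (Fin n), p.2 ∈ U → ContDiffAt ℝ 2 (fun p => V p.1 p.2) p)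
    (h : IsNewtonPair V U I x x') :
    ContinuousOn (fun t => spatialHessian (fun p => V p.1 p.2) (t, x t)) I := fun t ht =>
  ContinuousAt.comp_continuousWithinAt (f := fun s => (s, x s))
    (continuousAt_spatialHessian (hV (t, x t) (h.mapsTo ht)))
    (continuousWithinAt_id.prodMk (h.deriv_fst t ht).continuousWithinAt)

theorem IsLinearNewtonSolution.contDiffOn {E : Type*} [NormedAddCommGroup E]
    [InnerProductSpace ℝ E] (hI : UniqueDiffOn ℝ I)
    {A : ℝ → E →L[ℝ] E} (hA : ContinuousOn A I) {y p : ℝ → E}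
    (hy : IsLinearNewtonSolution A I y p) : ContDiffOn ℝ 2 y I := by
  have hp1 : ContDiffOn ℝ 1 p I := by
    have := contDiffOn_succ_of_hasDerivWithinAt hI (m := 0) (fun t ht => (hy t ht).2)
      (contDiffOn_zero.2 (hA.clm_apply fun t ht => (hy t ht).1.continuousWithinAt).neg)
    exact_mod_cast this
  have := contDiffOn_succ_of_hasDerivWithinAt hI (m := 1) (fun t ht => (hy t ht).1) hp1
  rwa [show ((1 : ℕ) : WithTop ℕ∞) + 1 = 2 by norm_num] at this

/-- Solutions of the linearized equation lift to Jacobi fields. -/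
theorem IsNewtonPair.isJacobiFieldOn (hI : UniqueDiffOn ℝ I)
    (hV : ∀ p : ℝ × EuclideanSpace ℝ (Fin n), p.2 ∈ U → ContDiffAt ℝ 2 (fun p => V p.1 p.2) p)
    (h : IsNewtonPair V U I x x') {v : ℝ → ℝ}
    (hv : ∀ t ∈ I, HasDerivWithinAt v (liftVelocity (fun p => V p.1 p.2) t (x t) (x' t)) I t)
    {y p : ℝ → EuclideanSpace ℝ (Fin n)}
    (hy : IsLinearNewtonSolution (fun t => spatialHessian (fun p => V p.1 p.2) (t, x t)) I y p) :
    IsJacobiFieldOn (ppMetric V) I (fun s => brinkmannPoint (v s) s (x s))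
      (fun s => brinkmannPoint (-⟪x' s, y s⟫) 0 (y s)) := by
  set W := fun p : ℝ × EuclideanSpace ℝ (Fin n) => V p.1 p.2 with hW
  have hx'2 := h.contDiffOn_deriv hI hV
  have hy2 := hy.contDiffOn hI (h.continuousOn_spatialHessian hV)
  have hWx : ∀ t ∈ I, ContDiffAt ℝ 2 W (t, x t) := fun t ht => hV (t, x t) (h.mapsTo ht)
  have hγ' : ∀ t ∈ I, derivWithin (fun s => brinkmannPoint (v s) s (x s)) I t =
      brinkmannPoint (liftVelocity W t (x t) (x' t)) 1 (x' t) := fun t ht =>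
    (h.hasDerivWithinAt_lift hv ht).derivWithin (hI t ht)
  -- The covariant derivative of the orthogonal lift of `w` is the orthogonal lift of `w'`: the
  -- Christoffel term cancels the contribution of `x''`. Applied twice below.
  have hcov : ∀ w w' : ℝ → EuclideanSpace ℝ (Fin n), ∀ X : ℝ → Fin 2 ⊕ Fin n → ℝ,
      (∀ t ∈ I, X t = brinkmannPoint (-⟪x' t, w t⟫) 0 (w t)) →
      (∀ t ∈ I, HasDerivWithinAt w (w' t) I t) → ∀ t ∈ I,
      covDerivAlong (ppMetric V) I (fun s => brinkmannPoint (v s) s (x s)) X t =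
        brinkmannPoint (-⟪x' t, w' t⟫) 0 (w' t) := by
    intro w w' X hX hw t ht
    have h1 : HasDerivWithinAt X (brinkmannPoint
        (-(⟪x' t, w' t⟫ + ⟪-spatialGradient W (t, x t), w t⟫)) 0 (w' t)) I t :=
      (((h.deriv_snd t ht).inner ℝ (hw t ht)).neg.brinkmannPoint
        (hasDerivWithinAt_const t I 0) (hw t ht)).congr hX (hX t ht)
    rw [covDerivAlong_ppMetric ((hWx t ht).differentiableAt two_ne_zero) rfl (hγ' t ht) (hX t ht)
      (h1.derivWithin (hI t ht))]
    congr 1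
    · rw [inner_neg_left]
      ring
    · simp
  refine ⟨?_, fun t ht => ?_⟩
  · rw [contDiffOn_pi]
    rintro (a | i)
    · fin_cases a
      · exact (hx'2.inner ℝ hy2).neg
      · exact contDiffOn_const
    · exact (EuclideanSpace.proj (𝕜 := ℝ) i).contDiff.comp_contDiffOn hy2
  · rw [hcov p _ _ (hcov y p _ (fun _ _ => rfl) fun t ht => (hy t ht).1)
      (fun t ht => (hy t ht).2) t ht, hγ' t ht, curvatureEndo_ppMetric (hWx t ht),
      brinkmannPoint_add, ← brinkmannPoint_zero]
    congr 1
    · rw [inner_neg_right, real_inner_comm]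
      ring
    · simp
    · simp [hW]

end GeodesicLift

/-! ### Globalizing the potential by a cutoff. -/

section Cutoff

open scoped Manifold ContDiff

/-- A function which is `C²` on a neighbourhood of a compact set agrees near that set with a
globally `C²` function. -/
theorem exists_contDiff_eqOn_nhds {F : Type*} [NormedAddCommGroup F] [NormedSpace ℝ F]
    [FiniteDimensional ℝ F] {K O : Set F} (hK : IsCompact K) (hO : IsOpen O) (hKO : K ⊆ O)
    {W : F → ℝ} (hW : ContDiffOn ℝ 2 W O) :
    ∃ W₁ : F → ℝ, ContDiff ℝ 2 W₁ ∧ ∃ N, IsOpen N ∧ K ⊆ N ∧ N ⊆ O ∧ EqOn W₁ W N := by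
  obtain ⟨L, hL, hKL, hLO⟩ := exists_compact_between hK hO hKO
  obtain ⟨χ, hχ1, hχ0, -⟩ := exists_contMDiffMap_one_nhds_of_subset_interior (n := 2) 𝓘(ℝ, F)
    hK.isClosed hKL
  have hχ : ContDiff ℝ 2 χ := χ.contMDiff.contDiff
  obtain ⟨N, hN, hKN, hχN⟩ := eventually_nhdsSet_iff_exists.1 hχ1
  refine ⟨fun p => χ p * W p, contDiff_iff_contDiffAt.2 fun p => ?_, N ∩ O, hN.inter hO,
    subset_inter hKN hKO, inter_subset_right, fun p hp => by simp [hχN p hp.1]⟩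
  by_cases hp : p ∈ O
  · exact hχ.contDiffAt.mul (hW.contDiffAt (hO.mem_nhds hp))
  · have hev : (fun p => χ p * W p) =ᶠ[𝓝 p] fun _ => 0 := by
      filter_upwards [hL.isClosed.isOpen_compl.mem_nhds fun h => hp (hLO h)] with q hq
      rw [hχ0 q hq, zero_mul]
    exact contDiffAt_const.congr_of_eventuallyEq hev

end Cutoff

/-! ### Variations of solutions in phase space. -/

section PhaseSpace

open scoped RealInnerProductSpace

variable {E : Type*} [NormedAddCommGroup E] [InnerProductSpace ℝ E] [CompleteSpace E]
  {W : ℝ × E → ℝ}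

theorem spatialGradient_congr {W₁ : ℝ × E → ℝ} {q : ℝ × E} (h : W₁ =ᶠ[𝓝 q] W) :
    spatialGradient W₁ q = spatialGradient W q := by
  rw [spatialGradient, spatialGradient, h.fderiv_eq]

theorem spatialHessian_congr {W₁ : ℝ × E → ℝ} {q : ℝ × E} (h : W₁ =ᶠ[𝓝 q] W) :
    spatialHessian W₁ q = spatialHessian W q := by
  rw [spatialHessian, spatialHessian, h.fderiv.fderiv_eq]

theorem continuous_spatialGradient (hW : ContDiff ℝ 2 W) : Continuous (spatialGradient W) :=
  continuous_iff_continuousAt.2 fun _ => (contDiffAt_spatialGradient hW.contDiffAt).continuousAt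

theorem continuous_spatialHessian (hW : ContDiff ℝ 2 W) : Continuous (spatialHessian W) :=
  continuous_iff_continuousAt.2 fun _ => continuousAt_spatialHessian hW.contDiffAt

/-- The Newton equation as a first order system on phase space. -/
noncomputable def newtonField (hW : ContDiff ℝ 2 W) (T : Set ℝ) : C(T × (E × E), E × E) where
  toFun q := (q.2.2, -spatialGradient W ((q.1 : ℝ), q.2.1))
  continuous_toFun := by
    have := continuous_spatialGradient hW
    fun_prop

/-- The derivative of `newtonField` in the phase space variable. -/
noncomputable def newtonFieldDeriv (hW : ContDiff ℝ 2 W) (T : Set ℝ) :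
    C(T × (E × E), (E × E) →L[ℝ] E × E) where
  toFun q := (ContinuousLinearMap.inl ℝ E E).comp (ContinuousLinearMap.snd ℝ E E) -
    (ContinuousLinearMap.inr ℝ E E).comp
      ((spatialHessian W ((q.1 : ℝ), q.2.1)).comp (ContinuousLinearMap.fst ℝ E E))
  continuous_toFun := by
    have h : Continuous fun q : T × (E × E) => spatialHessian W ((q.1 : ℝ), q.2.1) :=
      (continuous_spatialHessian hW).comp (by fun_prop)
    exact continuous_const.sub (continuous_const.clm_comp (h.clm_comp continuous_const))

theorem newtonFieldDeriv_apply (hW : ContDiff ℝ 2 W) (T : Set ℝ) (q : T × (E × E)) (z : E × E) :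
    newtonFieldDeriv hW T q z = (z.2, -spatialHessian W ((q.1 : ℝ), q.2.1) z.1) := by
  simp [newtonFieldDeriv]

theorem hasFDerivAt_newtonField (hW : ContDiff ℝ 2 W) (T : Set ℝ) (t : T) (z : E × E) :
    HasFDerivAt (fun z => newtonField hW T (t, z)) (newtonFieldDeriv hW T (t, z)) z := by
  have h1 : HasFDerivAt (fun z : E × E => spatialGradient W ((t : ℝ), z.1))
      ((spatialHessian W ((t : ℝ), z.1)).comp (ContinuousLinearMap.fst ℝ E E)) z :=
    (hasFDerivAt_spatialGradient_slice hW.contDiffAt).comp z hasFDerivAt_fst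
  have h2 := (hasFDerivAt_snd (𝕜 := ℝ) (p := z)).prodMk h1.neg
  refine h2.congr_fderiv (ContinuousLinearMap.ext fun w => ?_)
  rw [newtonFieldDeriv_apply]
  rfl

/-- The integrand giving the `v` coordinate of a lift. -/
noncomputable def lagrangianField (hW : ContDiff ℝ 2 W) (T : Set ℝ) : C(T × (E × E), ℝ) where
  toFun q := W ((q.1 : ℝ), q.2.1) - (1 / 2) * ⟪q.2.2, q.2.2⟫
  continuous_toFun := by
    have := hW.continuous
    fun_prop

/-- The derivative of `lagrangianField` in the phase space variable. -/
noncomputable def lagrangianFieldDeriv (hW : ContDiff ℝ 2 W) (T : Set ℝ) :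
    C(T × (E × E), (E × E) →L[ℝ] ℝ) where
  toFun q := (innerSL ℝ (spatialGradient W ((q.1 : ℝ), q.2.1))).comp
      (ContinuousLinearMap.fst ℝ E E) -
    (innerSL ℝ q.2.2).comp (ContinuousLinearMap.snd ℝ E E)
  continuous_toFun := by
    have h := continuous_spatialGradient hW
    exact (((innerSL ℝ).continuous.comp (h.comp (by fun_prop))).clm_comp continuous_const).sub
      (((innerSL ℝ).continuous.comp (by fun_prop)).clm_comp continuous_const)

theorem lagrangianFieldDeriv_apply (hW : ContDiff ℝ 2 W) (T : Set ℝ) (q : T × (E × E))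
    (z : E × E) : lagrangianFieldDeriv hW T q z =
      ⟪spatialGradient W ((q.1 : ℝ), q.2.1), z.1⟫ - ⟪q.2.2, z.2⟫ := by
  simp [lagrangianFieldDeriv]

theorem hasFDerivAt_lagrangianField (hW : ContDiff ℝ 2 W) (T : Set ℝ) (t : T) (z : E × E) :
    HasFDerivAt (fun z => lagrangianField hW T (t, z)) (lagrangianFieldDeriv hW T (t, z)) z := by
  have h1 : HasFDerivAt (fun z : E × E => W ((t : ℝ), z.1))
      (((fderiv ℝ W (t, z.1)).comp (ContinuousLinearMap.inr ℝ ℝ E)).comp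
        (ContinuousLinearMap.fst ℝ E E)) z :=
    (hasFDerivAt_slice (hW.differentiable two_ne_zero).differentiableAt).comp z hasFDerivAt_fst
  have h2 := (hasFDerivAt_snd (𝕜 := ℝ) (p := z)).inner ℝ (hasFDerivAt_snd (𝕜 := ℝ) (p := z))
  refine (h1.sub (h2.const_mul (1 / 2))).congr_fderiv
    (ContinuousLinearMap.ext fun w => ?_)
  rw [lagrangianFieldDeriv_apply, inner_spatialGradient]
  simp [real_inner_comm]
  ring

variable {a b : ℝ}

/-- Every solution of the linearized equation is the infinitesimal variation of a family of
solutions of the Newton equation. -/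
theorem exists_phase_family (hW : ContDiff ℝ 2 W) (hab : a ≤ b) {x x' y p : ℝ → E}
    (hx : ∀ t ∈ Icc a b, HasDerivWithinAt x (x' t) (Icc a b) t)
    (hx' : ∀ t ∈ Icc a b, HasDerivWithinAt x' (-spatialGradient W (t, x t)) (Icc a b) t)
    (hy : IsLinearNewtonSolution (fun t => spatialHessian W (t, x t)) (Icc a b) y p) :
    ∃ (Ψ : ℝ → C(Icc a b, E × E)) (Y : C(Icc a b, E × E)), ContDiffAt ℝ 1 Ψ 0 ∧
      HasDerivAt Ψ Y 0 ∧ (∀ t : Icc a b, Ψ 0 t = (x t, x' t)) ∧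
      (∀ t : Icc a b, Y t = (y t, p t)) ∧
      ∀ᶠ s in 𝓝 (0 : ℝ), Ψ s = constantMapCLM _ _ ((x a, x' a) + s • (y a, p a)) +
        volterra hab (superposition (newtonField hW (Icc a b)) (Ψ s)) := by
  have hxc : ContinuousOn x (Icc a b) := fun t ht => (hx t ht).continuousWithinAt
  have hx'c : ContinuousOn x' (Icc a b) := fun t ht => (hx' t ht).continuousWithinAt
  have hyc : ContinuousOn y (Icc a b) := fun t ht => (hy t ht).1.continuousWithinAt
  have hpc : ContinuousOn p (Icc a b) := fun t ht => (hy t ht).2.continuousWithinAt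
  set u₀ : C(Icc a b, E × E) := ⟨fun t => (x t, x' t),
    continuousOn_iff_continuous_domRestrict.1 (hxc.prodMk hx'c)⟩ with hu₀d
  set Y : C(Icc a b, E × E) := ⟨fun t => (y t, p t),
    continuousOn_iff_continuous_domRestrict.1 (hyc.prodMk hpc)⟩ with hYd
  have hu₀ : u₀ = constantMapCLM _ _ (x a, x' a) +
      volterra hab (superposition (newtonField hW (Icc a b)) u₀) := by
    ext1 t
    exact eq_add_primitiveIcc hab (z := fun t => (x t, x' t))
      (w := superposition (newtonField hW (Icc a b)) u₀)
      (fun t ht => (hx t ht).prodMk (hx' t ht)) t.2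
  -- The linearized integral equation, which identifies `Y` as the derivative of the solution map in
  -- the direction `(y a, p a)`.
  have hY : Y = constantMapCLM _ _ (y a, p a) +
      volterra hab (pointwiseApply (superposition (newtonFieldDeriv hW (Icc a b)) u₀) Y) := by
    ext1 t
    refine eq_add_primitiveIcc hab (z := fun t => (y t, p t))
      (w := pointwiseApply (superposition (newtonFieldDeriv hW (Icc a b)) u₀) Y)
      (fun t ht => ?_) t.2
    rw [pointwiseApply_apply, superposition_apply, newtonFieldDeriv_apply]
    exact (hy t ht).1.prodMk (hy t ht).2
  obtain ⟨Φ, hΦc, hΦ0, hΦ, hΦd⟩ := exists_contDiffAt_solution_map hab _ _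
    (hasFDerivAt_newtonField hW (Icc a b)) u₀ _ hu₀
  set c : ℝ → E × E := fun s => (x a, x' a) + s • (y a, p a) with hc
  have hc0 : c 0 = (x a, x' a) := by simp [hc]
  have hcd : HasDerivAt c (y a, p a) 0 :=
    (((hasDerivAt_id (0 : ℝ)).smul_const (y a, p a)).const_add (x a, x' a)).congr_deriv
      (one_smul ℝ (y a, p a))
  have hcc : ContDiff ℝ 1 c := contDiff_const.add (contDiff_id.smul contDiff_const)
  refine ⟨Φ ∘ c, Y, ?_, ?_, ?_, fun _ => rfl, ?_⟩
  · rw [← hc0] at hΦc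
    exact hΦc.comp 0 hcc.contDiffAt
  · have h1 := (hΦc.differentiableAt one_ne_zero).hasFDerivAt
    rw [← hΦd _ _ hY]
    rw [← hc0] at h1 ⊢
    exact h1.comp_hasDerivAt 0 hcd
  · intro t
    rw [Function.comp_apply, hc0, hΦ0]
    rfl
  · have : Tendsto c (𝓝 0) (𝓝 (x a, x' a)) := by
      rw [← hc0]
      exact hcc.continuous.continuousAt
    exact this.eventually hΦ

end PhaseSpace

/-! ### The family of lifted solutions. -/

section Family

open scoped RealInnerProductSpace

variable {n : ℕ} {V : ℝ → EuclideanSpace ℝ (Fin n) → ℝ} {U : Set (EuclideanSpace ℝ (Fin n))}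

theorem IsNewtonPair.exists_isDistinctSolutionFamily (hU : IsOpen U)
    (hVon : ContDiffOn ℝ 2 (fun p : ℝ × EuclideanSpace ℝ (Fin n) => V p.1 p.2) (univ ×ˢ U))
    {a b : ℝ} (hab : a < b) {x x' : ℝ → EuclideanSpace ℝ (Fin n)}
    (h : IsNewtonPair V U (Icc a b) x x') {v : ℝ → ℝ}
    (hv : ∀ t ∈ Icc a b,
      HasDerivWithinAt v (liftVelocity (fun p => V p.1 p.2) t (x t) (x' t)) (Icc a b) t)
    {y p : ℝ → EuclideanSpace ℝ (Fin n)}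
    (hy : IsLinearNewtonSolution (fun t => spatialHessian (fun p => V p.1 p.2) (t, x t))
      (Icc a b) y p) (hya : y a = 0) (hpa : p a ≠ 0) :
    ∃ (ε : ℝ) (X : ℝ → ℝ → EuclideanSpace ℝ (Fin n)) (Γ : ℝ → ℝ → Fin 2 ⊕ Fin n → ℝ),
      IsDistinctSolutionFamily V U a b ε x (fun s => brinkmannPoint (v s) s (x s))
        (fun s => brinkmannPoint (-⟪x' s, y s⟫) 0 (y s)) X Γ := by
  set W := fun p : ℝ × EuclideanSpace ℝ (Fin n) => V p.1 p.2 with hW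
  have hO : IsOpen ((univ : Set ℝ) ×ˢ U) := isOpen_univ.prod hU
  have hV : ∀ q : ℝ × EuclideanSpace ℝ (Fin n), q.2 ∈ U → ContDiffAt ℝ 2 W q := fun q hq =>
    hVon.contDiffAt (hO.mem_nhds ⟨mem_univ _, hq⟩)
  have hI : UniqueDiffOn ℝ (Icc a b) := uniqueDiffOn_Icc hab
  have ha : a ∈ Icc a b := left_mem_Icc.2 hab.le
  have hxc : ContinuousOn (fun t => (t, x t)) (Icc a b) :=
    continuousOn_id.prodMk fun t ht => (h.deriv_fst t ht).continuousWithinAt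
  -- The superposition operators need a field on all of phase space, so `V` is replaced by a global
  -- `C²` function agreeing with it on a neighbourhood `N` of the graph of `x`.
  obtain ⟨W₁, hW₁, N, hN, hKN, hNO, hEq⟩ := exists_contDiff_eqOn_nhds
    (isCompact_Icc.image_of_continuousOn hxc) hO
    (by rintro _ ⟨t, ht, rfl⟩; exact ⟨mem_univ _, h.mapsTo ht⟩) hVon
  have hev : ∀ q ∈ N, W₁ =ᶠ[𝓝 q] W := fun q hq => hEq.eventuallyEq_of_mem (hN.mem_nhds hq)
  have hgrad : ∀ q ∈ N, spatialGradient W₁ q = spatialGradient W q := fun q hq =>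
    spatialGradient_congr (hev q hq)
  have hxN : ∀ t ∈ Icc a b, (t, x t) ∈ N := fun t ht => hKN ⟨t, ht, rfl⟩
  obtain ⟨Ψ, Y, hΨc, hΨd, hΨ0, hY, hΨ⟩ := exists_phase_family hW₁ hab.le (y := y) (p := p)
    h.deriv_fst (fun t ht => by rw [hgrad _ (hxN t ht)]; exact h.deriv_snd t ht)
    (fun t ht => ⟨(hy t ht).1, by
      beta_reduce
      rw [spatialHessian_congr (hev _ (hxN t ht))]
      exact (hy t ht).2⟩)
  rw [hya] at hΨ
  -- Functions mapping the compact interval into the open set `N` form an open set, so nearby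
  -- solutions stay where the two potentials agree and therefore solve the original equation in `U`.
  have hgraph : ∀ᶠ s in 𝓝 (0 : ℝ), ∀ t : Icc a b, ((t : ℝ), (Ψ s t).1) ∈ N := by
    set S : C(Icc a b × (EuclideanSpace ℝ (Fin n) × EuclideanSpace ℝ (Fin n)),
      ℝ × EuclideanSpace ℝ (Fin n)) := ⟨fun q => (q.1, q.2.1), by fun_prop⟩ with hS
    have ho : IsOpen {f : C(Icc a b, ℝ × EuclideanSpace ℝ (Fin n)) | MapsTo f univ N} :=
      ContinuousMap.isOpen_setOfPred_mapsTo isCompact_univ hN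
    have h0 : superposition S (Ψ 0) ∈
        {f : C(Icc a b, ℝ × EuclideanSpace ℝ (Fin n)) | MapsTo f univ N} := by
      intro t _
      simp only [superposition_apply, hS, ContinuousMap.coe_mk, hΨ0]
      exact hxN t t.2
    have hc : ContinuousAt (fun s => superposition S (Ψ s)) 0 :=
      (continuous_superposition S).continuousAt.comp hΨc.continuousAt
    filter_upwards [hc.eventually (ho.mem_nhds h0)] with s hs t
    exact hs (mem_univ t)
  obtain ⟨ε, hε, hball⟩ := Metric.eventually_nhds_iff_ball.1
    ((hΨc.eventually (by simp)).and (hΨ.and hgraph))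
  have hball' : ∀ s ∈ Ioo (-ε) ε, _ := fun s hs =>
    hball s (by rwa [Real.ball_eq_Ioo, zero_sub, zero_add])
  have h0ε : (0 : ℝ) ∈ Ioo (-ε) ε := ⟨neg_lt_zero.2 hε, hε⟩
  set X : ℝ → ℝ → EuclideanSpace ℝ (Fin n) := fun s t => (IccExtend hab.le (Ψ s) t).1 with hX
  set P : ℝ → ℝ → EuclideanSpace ℝ (Fin n) := fun s t => (IccExtend hab.le (Ψ s) t).2 with hP
  set vel : ℝ → ℝ → ℝ := fun s t => v a +
    primitiveIcc hab.le (superposition (lagrangianField hW₁ (Icc a b)) (Ψ s)) t with hvel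
  have hXN : ∀ s ∈ Ioo (-ε) ε, ∀ t ∈ Icc a b, (t, X s t) ∈ N := fun s hs t ht => by
    simp only [hX, IccExtend_of_mem hab.le _ ht]
    exact (hball' s hs).2.2 ⟨t, ht⟩
  have hZd : ∀ s ∈ Ioo (-ε) ε, ∀ t ∈ Icc a b, HasDerivWithinAt (IccExtend hab.le (Ψ s))
      (P s t, -spatialGradient W (t, X s t)) (Icc a b) t := fun s hs t ht => by
    have := hasDerivWithinAt_IccExtend hab.le (hball' s hs).2.1 ht
    rw [← hgrad _ (hXN s hs t ht)]
    simp only [hX, hP, IccExtend_of_mem hab.le _ ht]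
    exact this
  have hpair : ∀ s ∈ Ioo (-ε) ε, IsNewtonPair V U (Icc a b) (X s) (P s) := fun s hs =>
    { mapsTo := fun t ht => (hNO (hXN s hs t ht)).2
      deriv_fst := fun t ht =>
        (ContinuousLinearMap.fst ℝ (EuclideanSpace ℝ (Fin n))
          (EuclideanSpace ℝ (Fin n))).hasFDerivAt.comp_hasDerivWithinAt t (hZd s hs t ht)
      deriv_snd := fun t ht =>
        (ContinuousLinearMap.snd ℝ (EuclideanSpace ℝ (Fin n))
          (EuclideanSpace ℝ (Fin n))).hasFDerivAt.comp_hasDerivWithinAt t (hZd s hs t ht) }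
  have hveld : ∀ s ∈ Ioo (-ε) ε, ∀ t ∈ Icc a b,
      HasDerivWithinAt (vel s) (liftVelocity W t (X s t) (P s t)) (Icc a b) t := fun s hs t ht => by
    have h1 := ((hasDerivAt_primitiveIcc hab.le
      (superposition (lagrangianField hW₁ (Icc a b)) (Ψ s)) t).const_add (v a)).hasDerivWithinAt
      (s := Icc a b)
    refine h1.congr_deriv ?_
    rw [liftVelocity, ← hEq (hXN s hs t ht), IccExtend_of_mem hab.le _ ht]
    simp only [hX, hP, IccExtend_of_mem hab.le _ ht]
    rfl
  have hΨa : ∀ s ∈ Ioo (-ε) ε, IccExtend hab.le (Ψ s) a =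
      (x a, x' a) + s • ((0 : EuclideanSpace ℝ (Fin n)), p a) := fun s hs =>
    IccExtend_left_eq hab.le (hball' s hs).2.1
  have hXa : ∀ s ∈ Ioo (-ε) ε, X s a = x a := fun s hs => by
    simp only [hX, hΨa s hs]
    simp
  have hPa : ∀ s ∈ Ioo (-ε) ε, P s a = x' a + s • p a := fun s hs => by
    simp only [hP, hΨa s hs]
    simp
  have hX0 : EqOn (X 0) x (Icc a b) := fun t ht => by
    simp only [hX, IccExtend_of_mem hab.le _ ht, hΨ0]
  refine ⟨ε, X, fun s t => brinkmannPoint (vel s t) t (X s t), ?_⟩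
  constructor
  case pos => exact hε
  case solution => exact fun s hs => (hpair s hs).isNewtonSolutionOn hI hV
  case start => exact hXa
  case base => exact hX0
  case distinct =>
    intro s hs s' hs' hne heq
    -- Curves equal on `[a, b]` have equal one-sided derivatives at `a`, whereas the initial
    -- velocities `x' a + s • p a` differ.
    have e1 : P s a = P s' a := by
      rw [← ((hpair s hs).deriv_fst a ha).derivWithin (hI a ha),
        ← ((hpair s' hs').deriv_fst a ha).derivWithin (hI a ha)]
      exact derivWithin_congr heq (heq ha)
    rw [hPa s hs, hPa s' hs', add_right_inj] at e1
    exact hne (smul_left_injective ℝ hpa e1)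
  case lift => exact fun s hs => (hpair s hs).isGeodesicLiftOn hI hV (hveld s hs)
  case lift_start =>
    intro s hs
    simp only [hXa s hs, hvel, primitiveIcc_left, add_zero]
  case lift_base =>
    intro t ht
    have e1 : v t = vel 0 t := by
      refine eq_add_primitiveIcc hab.le (fun s hs => (hv s hs).congr_deriv ?_) ht
      rw [superposition_apply, hΨ0, liftVelocity, ← hEq (hxN s hs)]
      rfl
    simp only [hX0 ht, e1]
  case contDiffOn =>
    have hΨon : ContDiffOn ℝ 1 (fun q : ℝ × ℝ => Ψ q.1) (Ioo (-ε) ε ×ˢ Icc a b) := fun q hq =>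
      ((hball' q.1 hq.1).1.comp q contDiffAt_fst).contDiffWithinAt
    have hprim : ∀ {F : Type} [NormedAddCommGroup F] [NormedSpace ℝ F] [CompleteSpace F]
        (f : C(Icc a b × (EuclideanSpace ℝ (Fin n) × EuclideanSpace ℝ (Fin n)), F)),
        ContDiff ℝ 1 (superposition f) → ContDiffOn ℝ 1
        (fun q : ℝ × ℝ => primitiveIcc hab.le (superposition f (Ψ q.1)) q.2)
        (Ioo (-ε) ε ×ˢ Icc a b) := fun f hf =>
      (contDiff_primitiveIcc hab.le).comp_contDiffOn
        ((hf.comp_contDiffOn hΨon).prodMk contDiffOn_snd)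
    -- Evaluating a continuous function is not `C¹` in `t`. The integral equation rewrites `X`
    -- through a primitive, which is jointly `C¹`.
    have hXon : ContDiffOn ℝ 1 (fun q : ℝ × ℝ => X q.1 q.2) (Ioo (-ε) ε ×ˢ Icc a b) := by
      have h1 := contDiff_fst.comp_contDiffOn
        (hprim _ (contDiff_superposition _ _ (hasFDerivAt_newtonField hW₁ (Icc a b))))
      refine ((contDiffOn_const (c := x a)).add h1).congr fun q hq => ?_
      have := DFunLike.congr_fun (hball' q.1 hq.1).2.1 ⟨q.2, hq.2⟩
      simp only [hX, IccExtend_of_mem hab.le _ hq.2]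
      rw [this]
      simp
    rw [contDiffOn_pi]
    rintro (k | k)
    · fin_cases k
      · exact contDiffOn_const.add
          (hprim _ (contDiff_superposition _ _ (hasFDerivAt_lagrangianField hW₁ (Icc a b))))
      · exact contDiffOn_snd
    · exact (EuclideanSpace.proj (𝕜 := ℝ) k).contDiff.comp_contDiffOn hXon
  case variation =>
    intro t ht
    have hXd : HasDerivAt (fun s => X s t) (y t) 0 := by
      have := ((ContinuousLinearMap.fst ℝ _ _).comp
        (ContinuousMap.evalCLM ℝ (⟨t, ht⟩ : Icc a b))).hasFDerivAt.comp_hasDerivAt (0 : ℝ) hΨd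
      refine (this.congr_deriv ?_).congr_of_eventuallyEq (Eventually.of_forall fun s => ?_)
      · simp [hY]
      · simp [hX, IccExtend_of_mem hab.le _ ht]
    have hveld0 : HasDerivAt (fun s => vel s t) (-⟪x' t, y t⟫) 0 := by
      have h1 := (primitiveIccCLM hab.le t).hasFDerivAt.comp_hasDerivAt (0 : ℝ)
        ((hasFDerivAt_superposition _ _ (hasFDerivAt_lagrangianField hW₁ (Icc a b))
          (Ψ 0)).comp_hasDerivAt (0 : ℝ) hΨd)
      refine (h1.const_add (v a)).congr_deriv ?_
      -- The first variation formula: along a solution the varied integrand `⟪∇V, y⟫ - ⟪x', p⟫` is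
      -- the derivative of `-⟪x', y⟫`, and the boundary term at `a` vanishes with `y a`.
      have h2 := eq_add_primitiveIcc hab.le (z := fun t => -⟪x' t, y t⟫)
        (w := pointwiseApply (superposition (lagrangianFieldDeriv hW₁ (Icc a b)) (Ψ 0)) Y)
        (fun s hs => ?_) ht
      · rw [h2, hya, inner_zero_right, neg_zero, zero_add]
        rfl
      · refine ((h.deriv_snd s hs).inner ℝ (hy s hs).1).neg.congr_deriv ?_
        rw [pointwiseApply_apply, superposition_apply, lagrangianFieldDeriv_apply, hΨ0, hY,
          hgrad _ (hxN s hs), inner_neg_left]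
        ring
    rw [hasDerivAt_pi]
    rintro (k | k)
    · fin_cases k
      · exact hveld0
      · exact hasDerivAt_const _ _
    · exact (EuclideanSpace.proj (𝕜 := ℝ) k).hasFDerivAt.comp_hasDerivAt (0 : ℝ) hXd

end Family

/-! ### The main theorem. -/

theorem mainTheorem2 {n : ℕ} (U : Set (EuclideanSpace ℝ (Fin n)))
    (hU : IsOpen U) (hUc : IsConnected U)
    (V : ℝ → EuclideanSpace ℝ (Fin n) → ℝ)
    (hV : ContDiffOn ℝ 2 (fun p : ℝ × EuclideanSpace ℝ (Fin n) => V p.1 p.2) (Set.univ ×ˢ U))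
    (x : ℝ → EuclideanSpace ℝ (Fin n))
    (hx : IsNewtonSolutionOn V U Set.univ x)
    (hx_nonconst : ¬ ∃ c, ∀ t, x t = c)
    (t₀ : ℝ) (i : Fin n) (hi : deriv x t₀ i = 0)
    (hij : ∃ j : Fin n, iteratedFDeriv ℝ 2 (V t₀) (x t₀)
      ![EuclideanSpace.single i 1, EuclideanSpace.single j 1] ≠ 0)
    (hΔ : ∀ t, 0 ≤ Laplacian.laplacian (V t) (x t)) :
    ∃ γ : ℝ → Fin 2 ⊕ Fin n → ℝ,
      IsGeodesicLiftOn V U Set.univ x γ ∧ IsLightlikeOn (ppMetric V) Set.univ γ ∧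
      γ t₀ (Sum.inl 0) = 0 ∧
      ∃ t₁ t₂ : ℝ, t₁ < t₂ ∧
        ∃ J : ℝ → Fin 2 ⊕ Fin n → ℝ, IsConjugacyField (ppMetric V) t₁ t₂ γ J ∧
          ∃ (ε : ℝ) (X : ℝ → ℝ → EuclideanSpace ℝ (Fin n)) (Γ : ℝ → ℝ → Fin 2 ⊕ Fin n → ℝ),
            IsDistinctSolutionFamily V U t₁ t₂ ε x γ J X Γ := by
  set W := fun p : ℝ × EuclideanSpace ℝ (Fin n) => V p.1 p.2 with hW
  have hVat : ∀ q : ℝ × EuclideanSpace ℝ (Fin n), q.2 ∈ U → ContDiffAt ℝ 2 W q := fun q hq =>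
    hV.contDiffAt ((isOpen_univ.prod hU).mem_nhds ⟨mem_univ _, hq⟩)
  have hxU : ∀ t, x t ∈ U := fun t => hx.mapsTo (mem_univ t)
  obtain ⟨x', hpair⟩ : ∃ x', IsNewtonPair V U univ x x' := ⟨_, hx.isNewtonPair hVat⟩
  have hxc : Continuous x := continuous_iff_continuousAt.2 fun t =>
    (hasDerivWithinAt_univ.1 (hpair.deriv_fst t (mem_univ t))).continuousAt
  have hx'c : Continuous x' := continuous_iff_continuousAt.2 fun t =>
    (hasDerivWithinAt_univ.1 (hpair.deriv_snd t (mem_univ t))).continuousAt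
  set A := fun t => spatialHessian W (t, x t) with hA
  have hAc : Continuous A := continuousOn_univ.1 (hpair.continuousOn_spatialHessian hVat)
  have htr : ∀ t, 0 ≤ ∑ k, inner ℝ (A t (EuclideanSpace.basisFun (Fin n) ℝ k))
      (EuclideanSpace.basisFun (Fin n) ℝ k) := fun t => by
    have h1 := hΔ t
    rw [InnerProductSpace.laplacian_eq_iteratedFDeriv_orthonormalBasis (V t)
      (EuclideanSpace.basisFun (Fin n) ℝ)] at h1
    refine h1.trans_eq (Finset.sum_congr rfl fun k _ => ?_)
    exact iteratedFDeriv_two_slice (hVat (t, x t) (hxU t)) _ _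
  have hA0 : A t₀ ≠ 0 := fun h0 => by
    obtain ⟨j, hj⟩ := hij
    refine hj ((iteratedFDeriv_two_slice (hVat (t₀, x t₀) (hxU t₀)) _ _).trans ?_)
    change inner ℝ (A t₀ _) _ = (0 : ℝ)
    simp [h0]
  obtain ⟨t₁, t₂, h12, y, p, hy, hy1, hy2, hp⟩ := exists_conjugate_points hAc
    (fun t => inner_spatialHessian_comm (hVat (t, x t) (hxU t)))
    (EuclideanSpace.basisFun (Fin n) ℝ) htr hA0
  have hℓc : Continuous fun t => liftVelocity W t (x t) (x' t) := by
    refine Continuous.sub (continuous_iff_continuousAt.2 fun t => ?_) (by fun_prop)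
    exact ContinuousAt.comp (f := fun s => (s, x s)) (hVat (t, x t) (hxU t)).continuousAt
      (by fun_prop)
  set v : ℝ → ℝ := fun t => ∫ s in t₀..t, liftVelocity W s (x s) (x' s) with hvd
  have hv : ∀ t, HasDerivAt v (liftVelocity W t (x t) (x' t)) t := fun t =>
    hℓc.integral_hasStrictDerivAt t₀ t |>.hasDerivAt
  have hpairI := hpair.mono (subset_univ (Icc t₁ t₂))
  have hI := uniqueDiffOn_Icc h12
  refine ⟨fun s => brinkmannPoint (v s) s (x s),
    hpair.isGeodesicLiftOn uniqueDiffOn_univ hVat fun t _ => (hv t).hasDerivWithinAt,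
    hpair.isLightlikeOn uniqueDiffOn_univ fun t _ => (hv t).hasDerivWithinAt,
    by simp [brinkmannPoint, hvd], t₁, t₂, h12, _,
    ⟨hpairI.isJacobiFieldOn hI hVat (fun t _ => (hv t).hasDerivWithinAt) hy, ?_, ?_, ?_⟩,
    hpairI.exists_isDistinctSolutionFamily hU hV h12 (fun t _ => (hv t).hasDerivWithinAt)
      hy hy1 hp⟩
  -- If `J` vanished identically then so would `y`, and with it `p t₁ = y' t₁`.
  · by_contra! hzero
    refine hp ?_
    have hy0 : EqOn y (fun _ => 0) (Icc t₁ t₂) := fun t ht => by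
      ext k
      exact congrFun (hzero t ht) (Sum.inr k)
    have ht₁ : t₁ ∈ Icc t₁ t₂ := left_mem_Icc.2 h12.le
    rw [← (hy t₁ ht₁).1.derivWithin (hI t₁ ht₁), derivWithin_congr hy0 hy1]
    simp
  · simp [hy1]
  · simp [hy2]
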